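/- Let $1<p,q<\infty$, $t_0>0$ and $\mathcal I=[0,t_0]$, $|\mathcal I|=t_0$. Write $\|\cdot\|_{r,\mathcal I}$ for the norm of $L^r(\mathcal I)$, and $[x]^{r-1}=|x|^{r-2}x$ (equal to $0$ at $x=0$). Let $$W^{2,p}_{\mathrm D}(\mathcal I)=\{u\in W^{2,p}(\mathcal I):\ u(0)=u(t_0)=0\},\qquad \|u\|_{W^{2,p}_{\mathrm D}}=\|u''\|_{p,\mathcal I},$$ where $W^{2,p}(\mathcal I)$ is the real Sobolev space, and boundary values are those of the continuous representative. Consider the Navier eigenvalue problem $$([u'']^{p-1})''=\lambda\,[u]^{q-1}\ \text{ on } [0,t_0],\qquad u(0)=u(t_0)=u''(0)=u''(t_0)=0,\qquad u\neq 0,\ \lambda>0,$$ understood classically: $u\in C^2([0,t_0])$ and $[u'']^{p-1}\in C^2([0,t_0])$. A spectral couple on $[0,t_0]$ is a pair $(f,\lambda)$ that solves this problem with $\|f''\|_{p,\mathcal I}=1$ and $f'(0)>0$; then $\lambda$ is called a spectral number. There is exactly one spectral couple $(\operatorname{SN}_1,\operatorname{sn}_1)$ on $[0,t_0]$ whose function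 has no zeros in $(0,t_0)$, and $\operatorname{sn}_1$ is the smallest spectral number on $[0,t_0]$. Let $\lambda_1$ be the corresponding first spectral number for the unit interval $[0,1]$ (same $p,q$). Then the embedding $E_2:W^{2,p}_{\mathrm D}(\mathcal I)\to L^q(\mathcal I)$, $E_2u=u$, is well defined and bounded, and $$\|E_2\|=\sup_{0\ne u\in W^{2,p}_{\mathrm D}(\mathcal I)}\frac{\|u\|_{q,\mathcal I}}{\|u''\|_{p,\mathcal I}}=\|\operatorname{SN}_1\|_{q,\mathcal I}=\operatorname{sn}_1^{-1/q}=|\mathcal I|^{1/q-1/p+2}\,\lambda_1^{-1/q}.$$ -/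

import Mathlib

open MeasureTheory Set

noncomputable section

namespace Navier

/-- Lebesgue measure on the segment `[0, t₀]`. -/
abbrev segMeasure (t₀ : ℝ) : Measure ℝ := volume.restrict (Icc 0 t₀)

/-- `L^r([0, t₀])` for a finite real exponent `r`. -/
abbrev LSeg (r t₀ : ℝ) : Type := Lp ℝ (ENNReal.ofReal r) (segMeasure t₀)

instance factOneLeOfReal (r : ℝ) [h : Fact (1 < r)] : Fact (1 ≤ ENNReal.ofReal r) :=
  ⟨ENNReal.one_le_ofReal.2 h.out.le⟩

/-- `v` is the weak derivative of `u` on the open interval `(0, t₀)`, tested against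
smooth functions with compact support in `(0, t₀)`. -/
def HasWeakDeriv (t₀ : ℝ) (u v : ℝ → ℝ) : Prop :=
  ∀ φ : ℝ → ℝ, ContDiff ℝ (⊤ : ℕ∞) φ → HasCompactSupport φ → tsupport φ ⊆ Ioo 0 t₀ →
    ∫ t, u t * deriv φ t ∂(segMeasure t₀) = - ∫ t, v t * φ t ∂(segMeasure t₀)

/-- The class `u` has a representative that is continuous on `[0, t₀]` and vanishes at both
end points. -/
def VanishesAtEnds (t₀ : ℝ) (u : ℝ → ℝ) : Prop :=
  ∃ c : ℝ → ℝ, ContinuousOn c (Icc 0 t₀) ∧ u =ᵐ[segMeasure t₀] c ∧ c 0 = 0 ∧ c t₀ = 0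

section Closure

variable {p t₀ : ℝ}

lemma integrable_mul_test [Fact (1 < p)] (u : LSeg p t₀) {ψ : ℝ → ℝ} (hψ : Continuous ψ)
    (hc : HasCompactSupport ψ) : Integrable (fun t => u t * ψ t) (segMeasure t₀) := by
  have hu : Integrable u (segMeasure t₀) := (Lp.memLp u).integrable Fact.out
  obtain ⟨C, hC⟩ := hψ.bounded_above_of_compact_support hc
  exact hu.mul_bdd (c := C) hψ.aestronglyMeasurable (Filter.Eventually.of_forall hC)

lemma hasWeakDeriv_add [Fact (1 < p)] {u u' v v' : LSeg p t₀} (h : HasWeakDeriv t₀ u v)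
    (h' : HasWeakDeriv t₀ u' v') :
    HasWeakDeriv t₀ (u + u' : LSeg p t₀) (v + v' : LSeg p t₀) := by
  intro φ hφ hc hs
  have hd : Continuous (deriv φ) := hφ.continuous_deriv (by simp)
  have e1 : ∫ t, (u + u' : LSeg p t₀) t * deriv φ t ∂(segMeasure t₀)
      = ∫ t, (u t * deriv φ t + u' t * deriv φ t) ∂(segMeasure t₀) := by
    refine integral_congr_ae ?_
    filter_upwards [Lp.coeFn_add u u'] with t ht
    rw [ht, Pi.add_apply, add_mul]
  have e2 : ∫ t, (v + v' : LSeg p t₀) t * φ t ∂(segMeasure t₀)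
      = ∫ t, (v t * φ t + v' t * φ t) ∂(segMeasure t₀) := by
    refine integral_congr_ae ?_
    filter_upwards [Lp.coeFn_add v v'] with t ht
    rw [ht, Pi.add_apply, add_mul]
  rw [e1, e2, integral_add (integrable_mul_test u hd hc.deriv) (integrable_mul_test u' hd hc.deriv),
    integral_add (integrable_mul_test v hφ.continuous hc) (integrable_mul_test v' hφ.continuous hc),
    h φ hφ hc hs, h' φ hφ hc hs, neg_add]

lemma hasWeakDeriv_smul (a : ℝ) {u v : LSeg p t₀} (h : HasWeakDeriv t₀ u v) :
    HasWeakDeriv t₀ (a • u : LSeg p t₀) (a • v : LSeg p t₀) := by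
  intro φ hφ hc hs
  have e1 : ∫ t, (a • u : LSeg p t₀) t * deriv φ t ∂(segMeasure t₀)
      = ∫ t, a * (u t * deriv φ t) ∂(segMeasure t₀) := by
    refine integral_congr_ae ?_
    filter_upwards [Lp.coeFn_smul a u] with t ht
    rw [ht, Pi.smul_apply, smul_eq_mul, mul_assoc]
  have e2 : ∫ t, (a • v : LSeg p t₀) t * φ t ∂(segMeasure t₀)
      = ∫ t, a * (v t * φ t) ∂(segMeasure t₀) := by
    refine integral_congr_ae ?_
    filter_upwards [Lp.coeFn_smul a v] with t ht
    rw [ht, Pi.smul_apply, smul_eq_mul, mul_assoc]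
  rw [e1, e2, integral_const_mul, integral_const_mul, h φ hφ hc hs, mul_neg]

lemma vanishesAtEnds_add {u u' : LSeg p t₀} (h : VanishesAtEnds t₀ u)
    (h' : VanishesAtEnds t₀ u') : VanishesAtEnds t₀ (u + u' : LSeg p t₀) := by
  obtain ⟨c, hc, he, h0, h1⟩ := h
  obtain ⟨c', hc', he', h0', h1'⟩ := h'
  refine ⟨fun t => c t + c' t, hc.add hc', ?_, by simp [h0, h0'], by simp [h1, h1']⟩
  filter_upwards [Lp.coeFn_add u u', he, he'] with t ht e e'
  rw [ht, Pi.add_apply, e, e']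

lemma vanishesAtEnds_smul (a : ℝ) {u : LSeg p t₀} (h : VanishesAtEnds t₀ u) :
    VanishesAtEnds t₀ (a • u : LSeg p t₀) := by
  obtain ⟨c, hc, he, h0, h1⟩ := h
  refine ⟨fun t => a * c t, continuousOn_const.mul hc, ?_, by simp [h0], by simp [h1]⟩
  filter_upwards [Lp.coeFn_smul a u, he] with t ht e
  rw [ht, Pi.smul_apply, smul_eq_mul, e]

end Closure

/-- The triples `(u, u', u'')` in `L^p × L^p × L^p` in which `u'` is the weak derivative of `u`,
`u''` is the weak derivative of `u'`, and `u` vanishes at `0` and `t₀`. Weak derivatives being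
unique, these triples are in bijection with the functions `u ∈ W^{2,p}([0, t₀])` with
`u(0) = u(t₀) = 0`. -/
def sobolevSubmodule (p t₀ : ℝ) [Fact (1 < p)] :
    Submodule ℝ (LSeg p t₀ × LSeg p t₀ × LSeg p t₀) where
  carrier := {x | HasWeakDeriv t₀ x.1 x.2.1 ∧ HasWeakDeriv t₀ x.2.1 x.2.2 ∧
    VanishesAtEnds t₀ x.1}
  add_mem' := fun ha hb => ⟨hasWeakDeriv_add ha.1 hb.1, hasWeakDeriv_add ha.2.1 hb.2.1,
    vanishesAtEnds_add ha.2.2 hb.2.2⟩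
  zero_mem' := by
    have hw : HasWeakDeriv t₀ (0 : LSeg p t₀) (0 : LSeg p t₀) := by
      intro φ _ _ _
      have e (ψ : ℝ → ℝ) : ∫ t, (0 : LSeg p t₀) t * ψ t ∂(segMeasure t₀) = 0 := by
        refine integral_eq_zero_of_ae ?_
        filter_upwards [Lp.coeFn_zero ℝ (ENNReal.ofReal p) (segMeasure t₀)] with t ht
        rw [ht]
        simp
      rw [e, e, neg_zero]
    exact ⟨hw, hw, fun _ => 0, continuousOn_const, Lp.coeFn_zero _ _ _, rfl, rfl⟩
  smul_mem' := fun a _ hx => ⟨hasWeakDeriv_smul a hx.1, hasWeakDeriv_smul a hx.2.1,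
    vanishesAtEnds_smul a hx.2.2⟩

/-- The Sobolev space `W^{2,p}_D([0, t₀])`. -/
def SobolevD (p t₀ : ℝ) [Fact (1 < p)] : Type := sobolevSubmodule p t₀

namespace SobolevD

variable {p t₀ : ℝ} [Fact (1 < p)]

instance : AddCommGroup (SobolevD p t₀) := inferInstanceAs (AddCommGroup (sobolevSubmodule p t₀))

instance : Module ℝ (SobolevD p t₀) := inferInstanceAs (Module ℝ (sobolevSubmodule p t₀))

/-- The underlying function (class) `u`. -/
def fn (u : SobolevD p t₀) : LSeg p t₀ := u.1.1

/-- The second weak derivative `u''`, as a linear function of `u`. -/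
def deriv2 : SobolevD p t₀ →ₗ[ℝ] LSeg p t₀ where
  toFun u := u.1.2.2
  map_add' _ _ := rfl
  map_smul' _ _ := rfl

/-- `W^{2,p}_D` carries the norm `‖u‖ = ‖u''‖_p`. -/
instance : SeminormedAddCommGroup (SobolevD p t₀) :=
  SeminormedAddCommGroup.induced (SobolevD p t₀) (LSeg p t₀) (deriv2 (p := p) (t₀ := t₀))

instance : NormedSpace ℝ (SobolevD p t₀) :=
  NormedSpace.induced ℝ (SobolevD p t₀) (LSeg p t₀) (deriv2 (p := p) (t₀ := t₀))

lemma norm_eq (u : SobolevD p t₀) : ‖u‖ = ‖deriv2 u‖ := rfl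

end SobolevD

/-- The signed power `[x]^{r-1} = |x|^{r-2} x`, equal to `0` at `x = 0`. -/
def signedPow (r x : ℝ) : ℝ := |x| ^ (r - 2) * x

/-- The norm of `g` in `L^r([0, t₀])`. -/
def segNorm (r t₀ : ℝ) (g : ℝ → ℝ) : ℝ :=
  (eLpNorm g (ENNReal.ofReal r) (segMeasure t₀)).toReal

/-- First derivative on the segment `[0, t₀]`, one-sided at the end points. -/
def segDeriv (t₀ : ℝ) (u : ℝ → ℝ) : ℝ → ℝ := derivWithin u (Icc 0 t₀)

/-- Second derivative on the segment `[0, t₀]`, one-sided at the end points. -/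
def segDeriv2 (t₀ : ℝ) (u : ℝ → ℝ) : ℝ → ℝ := segDeriv t₀ (segDeriv t₀ u)

/-- `(u, lam)` solves `([u'']^{p-1})'' = lam [u]^{q-1}` on `[0, t₀]` with the Navier boundary
conditions `u(0) = u(t₀) = u''(0) = u''(t₀) = 0`, `u ≠ 0` and `lam > 0`. Only the values of `u`
on `[0, t₀]` matter. -/
structure IsEigenpair (p q t₀ : ℝ) (u : ℝ → ℝ) (lam : ℝ) : Prop where
  contDiffOn : ContDiffOn ℝ 2 u (Icc 0 t₀)
  contDiffOn_pow : ContDiffOn ℝ 2 (fun t => signedPow p (segDeriv2 t₀ u t)) (Icc 0 t₀)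
  equation : ∀ t ∈ Icc 0 t₀,
    segDeriv2 t₀ (fun s => signedPow p (segDeriv2 t₀ u s)) t = lam * signedPow q (u t)
  left : u 0 = 0
  right : u t₀ = 0
  left_deriv2 : segDeriv2 t₀ u 0 = 0
  right_deriv2 : segDeriv2 t₀ u t₀ = 0
  nontrivial : ∃ t ∈ Icc 0 t₀, u t ≠ 0
  pos : 0 < lam

/-- A spectral couple on `[0, t₀]`: an eigenpair `(f, lam)` with `‖f''‖_p = 1`, `f'(0) > 0`. -/
structure IsSpectralCouple (p q t₀ : ℝ) (f : ℝ → ℝ) (lam : ℝ) : Prop where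
  eigenpair : IsEigenpair p q t₀ f lam
  norm_deriv2 : segNorm p t₀ (segDeriv2 t₀ f) = 1
  deriv_zero_pos : 0 < segDeriv t₀ f 0

/-- A first spectral couple on `[0, t₀]`: one whose function has no zeros in `(0, t₀)`. -/
structure IsFirstSpectralCouple (p q t₀ : ℝ) (f : ℝ → ℝ) (lam : ℝ) : Prop where
  couple : IsSpectralCouple p q t₀ f lam
  ne_zero : ∀ t ∈ Ioo 0 t₀, f t ≠ 0

/-- `(f, lam)` is *the* first spectral couple on `[0, t₀]`: it is the only spectral couple whose
function has no zeros in `(0, t₀)`, and `lam` is the smallest of all spectral numbers. -/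
structure IsTheFirstSpectralCouple (p q t₀ : ℝ) (f : ℝ → ℝ) (lam : ℝ) : Prop where
  first : IsFirstSpectralCouple p q t₀ f lam
  unique : ∀ (g : ℝ → ℝ) (mu : ℝ), IsFirstSpectralCouple p q t₀ g mu →
    EqOn g f (Icc 0 t₀) ∧ mu = lam
  isLeast : IsLeast {mu : ℝ | ∃ g : ℝ → ℝ, IsSpectralCouple p q t₀ g mu} lam

end Navier

end

noncomputable section

/-! ### Green's function of the Dirichlet problem -/

namespace Navier

/-! Every `u` in the Sobolev space equals `G w`, where `w = -u''` and `G` is the Green operator of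
`-d²/dt²` with Dirichlet conditions (`SobolevD.fn_ae_eq_green`). The embedding constant to the power
`q` is therefore the supremum `K` of `∫ |G w|^q` over the unit ball of `L^p`. The kernel of `G` is
nonnegative, so `w ≥ 0` may be assumed.

The supremum `maxEnergy` is taken over continuous `w ≥ 0` only. A duality map repairs this and
supplies compactness: `dualDir` sends `w` to `(G((G w)^{q-1}))^{p'-1}`, and two applications of
Hölder's inequality (`energy_le`, `integral_energyGrad_mul_le`) show that, after normalization, this
map does not decrease the energy. It takes values in continuous functions, so the bound extends to
all of `L^p` (`energy_le_of_memLp`). Since `G` maps bounded sets of `L^1` to equi-Lipschitz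
families, Arzelà–Ascoli yields a maximizer (`exists_admissible_energy_eq`).

For a maximizer all these inequalities are equalities, so that `w^{p-1} = G((G w)^{q-1}) / K`
(`Admissible.euler_lagrange`). This says that `f = G w` is a positive eigenfunction with spectral
number `1/K`. Conversely, self-adjointness of `G` gives `λ ∫ |f|^q = ∫ |f''|^p = 1` for every
spectral couple, whence `λ ≥ 1/K`: the spectral number `1/K` is the least.

Uniqueness of the zero-free couple is an ODE argument for the system `-u'' = v^a`, `-v'' = λ u^b`.
Scaling matches `λ` and the slope `u'(0)`. A comparison argument then forces equal slopes `v'(0)`,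
and a Gronwall estimate adapted to the possibly non-Lipschitz powers at `0` identifies the solutions
(`IsPosSol.exists_eq_const_mul`). The power of the length comes from dilating maximizers
(`maxEnergy_eq`). -/

/-- Green's function of `-u''` on `[0, T]` with Dirichlet boundary conditions. -/
def greenKernel (T t s : ℝ) : ℝ := t * (T - s) / T - max (t - s) 0

/-- The solution operator of `-u'' = w`, `u(0) = u(T) = 0`. -/
def green (T : ℝ) (w : ℝ → ℝ) (t : ℝ) : ℝ := ∫ s, greenKernel T t s * w s ∂(segMeasure T)

variable {T : ℝ}

lemma ae_mem_seg (T : ℝ) : ∀ᵐ s ∂(segMeasure T), s ∈ Icc 0 T :=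
  ae_restrict_mem measurableSet_Icc

lemma continuous_greenKernel (T : ℝ) : Continuous fun x : ℝ × ℝ => greenKernel T x.1 x.2 := by
  unfold greenKernel; fun_prop

lemma continuous_greenKernel_right (T t : ℝ) : Continuous (greenKernel T t) := by
  unfold greenKernel; fun_prop

lemma greenKernel_of_le {t s : ℝ} (h : t ≤ s) : greenKernel T t s = t * (T - s) / T := by
  rw [greenKernel, max_eq_right (by linarith), sub_zero]

lemma greenKernel_of_ge (hT : 0 < T) {t s : ℝ} (h : s ≤ t) :
    greenKernel T t s = s * (T - t) / T := by
  rw [greenKernel, max_eq_left (by linarith)]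
  field_simp
  ring

lemma greenKernel_symm (hT : 0 < T) (t s : ℝ) : greenKernel T t s = greenKernel T s t := by
  rcases le_total t s with h | h
  · rw [greenKernel_of_le h, greenKernel_of_ge hT h]
  · rw [greenKernel_of_le h, greenKernel_of_ge hT h]

lemma greenKernel_nonneg (hT : 0 < T) {t s : ℝ} (ht : t ∈ Icc 0 T) (hs : s ∈ Icc 0 T) :
    0 ≤ greenKernel T t s := by
  rcases le_total t s with h | h
  · rw [greenKernel_of_le h]
    exact div_nonneg (mul_nonneg ht.1 (by linarith [hs.2])) hT.le
  · rw [greenKernel_of_ge hT h]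
    exact div_nonneg (mul_nonneg hs.1 (by linarith [ht.2])) hT.le

lemma greenKernel_pos (hT : 0 < T) {t s : ℝ} (ht : t ∈ Ioo 0 T) (hs : s ∈ Ioo 0 T) :
    0 < greenKernel T t s := by
  rcases le_total t s with h | h
  · rw [greenKernel_of_le h]
    exact div_pos (mul_pos ht.1 (by linarith [hs.2])) hT
  · rw [greenKernel_of_ge hT h]
    exact div_pos (mul_pos hs.1 (by linarith [ht.2])) hT

/-- For `t' ≤ t` the increment is a difference of two numbers that both lie in `[0, t - t']`. This
is what makes `green T w` Lipschitz with constant the `L^1` norm of `w`, the source of all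
compactness below. -/
lemma abs_greenKernel_sub_le (hT : 0 < T) (t t' : ℝ) {s : ℝ} (hs : s ∈ Icc 0 T) :
    |greenKernel T t s - greenKernel T t' s| ≤ |t - t'| := by
  wlog h : t' ≤ t generalizing t t'
  · rw [abs_sub_comm, abs_sub_comm t]
    exact this t' t (le_of_not_ge h)
  have e : greenKernel T t s - greenKernel T t' s
      = (t - t') * ((T - s) / T) - (max (t - s) 0 - max (t' - s) 0) := by
    unfold greenKernel; ring
  have h1 : 0 ≤ (T - s) / T := div_nonneg (by linarith [hs.2]) hT.le
  have h2 : (T - s) / T ≤ 1 := (div_le_one hT).2 (by linarith [hs.1])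
  have h3 : 0 ≤ (t - t') * ((T - s) / T) := mul_nonneg (by linarith) h1
  have h4 : (t - t') * ((T - s) / T) ≤ t - t' := mul_le_of_le_one_right (by linarith) h2
  have h5 : max (t' - s) 0 ≤ max (t - s) 0 := max_le_max (by linarith) le_rfl
  have h6 : max (t - s) 0 ≤ max (t' - s) 0 + (t - t') :=
    max_le (by linarith [le_max_left (t' - s) 0]) (by linarith [le_max_right (t' - s) 0])
  rw [e, abs_of_nonneg (sub_nonneg.2 h), abs_le]
  constructor <;> linarith

lemma greenKernel_zero (T : ℝ) {s : ℝ} (hs : s ∈ Icc 0 T) : greenKernel T 0 s = 0 := by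
  rw [greenKernel_of_le hs.1]; simp

lemma greenKernel_end (hT : 0 < T) {s : ℝ} (hs : s ∈ Icc 0 T) : greenKernel T T s = 0 := by
  rw [greenKernel_of_ge hT hs.2]; simp

lemma abs_greenKernel_le (hT : 0 < T) (t : ℝ) {s : ℝ} (hs : s ∈ Icc 0 T) :
    |greenKernel T t s| ≤ |t| := by
  simpa [greenKernel_zero T hs] using abs_greenKernel_sub_le hT t 0 hs

lemma integrable_seg {w : ℝ → ℝ} (hw : ContinuousOn w (Icc 0 T)) :
    Integrable w (segMeasure T) := hw.integrableOn_Icc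

lemma integral_seg (hT : 0 ≤ T) (w : ℝ → ℝ) :
    ∫ s, w s ∂(segMeasure T) = ∫ s in (0:ℝ)..T, w s := by
  rw [intervalIntegral.integral_of_le hT, integral_Icc_eq_integral_Ioc]

lemma integral_seg_congr {f g : ℝ → ℝ} (h : EqOn f g (Icc 0 T)) :
    ∫ s, f s ∂(segMeasure T) = ∫ s, g s ∂(segMeasure T) :=
  setIntegral_congr_fun measurableSet_Icc h

lemma integrable_greenKernel_mul (hT : 0 < T) {w : ℝ → ℝ} (hw : Integrable w (segMeasure T))
    (t : ℝ) : Integrable (fun s => greenKernel T t s * w s) (segMeasure T) := by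
  refine hw.bdd_mul (c := |t|) (continuous_greenKernel_right T t).aestronglyMeasurable ?_
  filter_upwards [ae_mem_seg T] with s hs
  exact abs_greenKernel_le hT t hs

lemma green_congr {w w' : ℝ → ℝ} (h : w =ᵐ[segMeasure T] w') : green T w = green T w' := by
  funext t
  refine integral_congr_ae ?_
  filter_upwards [h] with s hs
  rw [hs]

lemma green_congr_on {w w' : ℝ → ℝ} (h : EqOn w w' (Icc 0 T)) : green T w = green T w' :=
  green_congr (by filter_upwards [ae_mem_seg T] with s hs using h hs)

lemma green_zero (T : ℝ) (w : ℝ → ℝ) : green T w 0 = 0 := by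
  refine integral_eq_zero_of_ae ?_
  filter_upwards [ae_mem_seg T] with s hs
  simp [greenKernel_zero T hs]

lemma green_end (hT : 0 < T) (w : ℝ → ℝ) : green T w T = 0 := by
  refine integral_eq_zero_of_ae ?_
  filter_upwards [ae_mem_seg T] with s hs
  simp [greenKernel_end hT hs]

lemma abs_green_sub_le (hT : 0 < T) {w : ℝ → ℝ} (hw : Integrable w (segMeasure T)) (t t' : ℝ) :
    |green T w t - green T w t'| ≤ (∫ s, |w s| ∂(segMeasure T)) * |t - t'| := by
  rw [green, green, ← integral_sub (integrable_greenKernel_mul hT hw t)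
    (integrable_greenKernel_mul hT hw t'), mul_comm, ← integral_const_mul]
  rw [← Real.norm_eq_abs]
  refine norm_integral_le_of_norm_le (hw.abs.const_mul _) ?_
  filter_upwards [ae_mem_seg T] with s hs
  rw [← sub_mul, norm_mul]
  exact mul_le_mul_of_nonneg_right (abs_greenKernel_sub_le hT t t' hs) (norm_nonneg _)

lemma abs_green_le (hT : 0 < T) {w : ℝ → ℝ} (hw : Integrable w (segMeasure T)) {t : ℝ}
    (ht : t ∈ Icc 0 T) : |green T w t| ≤ (∫ s, |w s| ∂(segMeasure T)) * T := by
  have h := abs_green_sub_le hT hw t 0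
  rw [green_zero, sub_zero, sub_zero] at h
  refine h.trans (mul_le_mul_of_nonneg_left ?_ (integral_nonneg fun _ => abs_nonneg _))
  rw [abs_of_nonneg ht.1]
  exact ht.2

lemma continuous_green (hT : 0 < T) {w : ℝ → ℝ} (hw : Integrable w (segMeasure T)) :
    Continuous (green T w) := by
  have : LipschitzWith (∫ s, |w s| ∂(segMeasure T)).toNNReal (green T w) := by
    refine LipschitzWith.of_dist_le_mul fun t t' => ?_
    rw [Real.dist_eq, Real.dist_eq, Real.coe_toNNReal _ (integral_nonneg fun _ => abs_nonneg _)]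
    exact abs_green_sub_le hT hw t t'
  exact this.continuous

lemma green_nonneg (hT : 0 < T) {w : ℝ → ℝ} (hw : ∀ᵐ s ∂(segMeasure T), 0 ≤ w s) {t : ℝ}
    (ht : t ∈ Icc 0 T) : 0 ≤ green T w t := by
  refine integral_nonneg_of_ae ?_
  filter_upwards [ae_mem_seg T, hw] with s hs h
  exact mul_nonneg (greenKernel_nonneg hT ht hs) h

lemma abs_green_le_green_abs (hT : 0 < T) (w : ℝ → ℝ) {t : ℝ} (ht : t ∈ Icc 0 T) :
    |green T w t| ≤ green T (fun s => |w s|) t := by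
  rw [← Real.norm_eq_abs]
  refine (norm_integral_le_integral_norm _).trans (le_of_eq (integral_congr_ae ?_))
  filter_upwards [ae_mem_seg T] with s hs
  rw [norm_mul, Real.norm_of_nonneg (greenKernel_nonneg hT ht hs), Real.norm_eq_abs]

lemma integral_seg_pos (hT : 0 < T) {w : ℝ → ℝ} (hc : ContinuousOn w (Icc 0 T))
    (h0 : ∀ s ∈ Icc 0 T, 0 ≤ w s) {t : ℝ} (ht : t ∈ Icc 0 T) (hp : 0 < w t) :
    0 < ∫ s, w s ∂(segMeasure T) := by
  rw [integral_seg hT.le]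
  exact intervalIntegral.integral_pos hT hc (fun s hs => h0 s ⟨hs.1.le, hs.2⟩) ⟨t, ht, hp⟩

lemma eqOn_zero_of_integral_seg_le (hT : 0 < T) {w : ℝ → ℝ} (hc : ContinuousOn w (Icc 0 T))
    (h0 : ∀ s ∈ Icc 0 T, 0 ≤ w s) (h : ∫ s, w s ∂(segMeasure T) ≤ 0) {t : ℝ}
    (ht : t ∈ Icc 0 T) : w t = 0 := by
  by_contra hne
  exact absurd (integral_seg_pos hT hc h0 ht ((h0 t ht).lt_of_ne (Ne.symm hne))) (not_lt.2 h)

/-- Needed because the kernel is strictly positive only in the interior: positivity at an end point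
has to be moved inside by continuity. -/
lemma exists_mem_Ioo_pos (hT : 0 < T) {w : ℝ → ℝ} (hc : ContinuousOn w (Icc 0 T)) {t : ℝ}
    (ht : t ∈ Icc 0 T) (hp : 0 < w t) : ∃ s ∈ Ioo 0 T, 0 < w s := by
  by_contra! h
  have hcl : closure (Ioo 0 T) = Icc (0:ℝ) T := closure_Ioo hT.ne
  have : w t ∈ closure (Iic (0:ℝ)) := by
    have hm : MapsTo w (Ioo 0 T) (Iic 0) := fun s hs => h s hs
    exact hm.closure_of_continuousOn (by rwa [hcl]) (by rwa [hcl])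
  rw [closure_Iic] at this
  exact absurd hp (not_lt.2 this)

lemma green_pos (hT : 0 < T) {w : ℝ → ℝ} (hc : ContinuousOn w (Icc 0 T))
    (h0 : ∀ s ∈ Icc 0 T, 0 ≤ w s) {t₁ : ℝ} (ht₁ : t₁ ∈ Icc 0 T) (hp : 0 < w t₁) {t : ℝ}
    (ht : t ∈ Ioo 0 T) : 0 < green T w t := by
  obtain ⟨s, hs, hsp⟩ := exists_mem_Ioo_pos hT hc ht₁ hp
  exact integral_seg_pos hT ((continuous_greenKernel_right T t).continuousOn.mul hc)
    (fun x hx => mul_nonneg (greenKernel_nonneg hT (Ioo_subset_Icc_self ht) hx) (h0 x hx))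
    (Ioo_subset_Icc_self hs) (mul_pos (greenKernel_pos hT ht hs) hsp)

/-- Self-adjointness of `G`: Fubini together with the symmetry of the kernel. -/
lemma integral_mul_green (hT : 0 < T) {f w : ℝ → ℝ} (hf : Integrable f (segMeasure T))
    (hw : Integrable w (segMeasure T)) :
    ∫ t, f t * green T w t ∂(segMeasure T) = ∫ s, green T f s * w s ∂(segMeasure T) := by
  have hint : Integrable (fun x : ℝ × ℝ => f x.1 * (greenKernel T x.1 x.2 * w x.2))
      ((segMeasure T).prod (segMeasure T)) := by
    have h1 : Integrable (fun x : ℝ × ℝ => f x.1 * w x.2)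
        ((segMeasure T).prod (segMeasure T)) := hf.mul_prod hw
    have h2 : Integrable (fun x : ℝ × ℝ => greenKernel T x.1 x.2 * (f x.1 * w x.2))
        ((segMeasure T).prod (segMeasure T)) := by
      refine h1.bdd_mul (c := T) (continuous_greenKernel T).aestronglyMeasurable ?_
      have : ∀ᵐ x ∂((segMeasure T).prod (segMeasure T)), x ∈ Icc 0 T ×ˢ Icc 0 T := by
        rw [Measure.prod_restrict]
        exact ae_restrict_mem (measurableSet_Icc.prod measurableSet_Icc)
      filter_upwards [this] with x hx
      refine (abs_greenKernel_le hT x.1 hx.2).trans ?_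
      rw [abs_of_nonneg hx.1.1]
      exact hx.1.2
    refine h2.congr (Filter.Eventually.of_forall fun x => ?_)
    simp only; ring
  calc ∫ t, f t * green T w t ∂(segMeasure T)
      = ∫ t, ∫ s, f t * (greenKernel T t s * w s) ∂(segMeasure T) ∂(segMeasure T) := by
        refine integral_congr_ae (Filter.Eventually.of_forall fun t => ?_)
        simp only [green, ← integral_const_mul]
    _ = ∫ s, ∫ t, f t * (greenKernel T t s * w s) ∂(segMeasure T) ∂(segMeasure T) :=
        integral_integral_swap hint
    _ = ∫ s, green T f s * w s ∂(segMeasure T) := by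
        refine integral_congr_ae (Filter.Eventually.of_forall fun s => ?_)
        simp only [green, ← integral_mul_const]
        refine integral_congr_ae (Filter.Eventually.of_forall fun t => ?_)
        simp only
        rw [greenKernel_symm hT s t]; ring

/-! ### The Green operator as inverse of the second derivative. -/

/-- The derivative of `green T w`. -/
def greenDeriv (T : ℝ) (w : ℝ → ℝ) (t : ℝ) : ℝ :=
  (∫ s in (0:ℝ)..T, (T - s) / T * w s) - ∫ s in (0:ℝ)..t, w s

lemma green_eq (hT : 0 < T) {w : ℝ → ℝ} (hw : Continuous w) {t : ℝ} (ht : t ∈ Icc 0 T) :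
    green T w t = t * (∫ s in (0:ℝ)..T, (T - s) / T * w s)
      - (t * (∫ s in (0:ℝ)..t, w s) - ∫ s in (0:ℝ)..t, s * w s) := by
  have i1 : ∫ s in (0:ℝ)..T, max (t - s) 0 * w s = ∫ s in (0:ℝ)..t, (t - s) * w s := by
    have hc : Continuous fun s => max (t - s) 0 * w s := by fun_prop
    rw [← intervalIntegral.integral_add_adjacent_intervals (hc.intervalIntegrable 0 t)
      (hc.intervalIntegrable t T)]
    have z : ∫ s in t..T, max (t - s) 0 * w s = 0 := by
      rw [intervalIntegral.integral_congr (g := fun _ => 0), intervalIntegral.integral_zero]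
      intro s hs
      rw [uIcc_of_le ht.2] at hs
      simp only
      rw [max_eq_right (by linarith [hs.1]), zero_mul]
    rw [z, add_zero]
    refine intervalIntegral.integral_congr fun s hs => ?_
    rw [uIcc_of_le ht.1] at hs
    rw [max_eq_left (by linarith [hs.2])]
  have i2 : ∫ s in (0:ℝ)..t, (t - s) * w s
      = t * (∫ s in (0:ℝ)..t, w s) - ∫ s in (0:ℝ)..t, s * w s := by
    rw [← intervalIntegral.integral_const_mul, ← intervalIntegral.integral_sub]
    · refine intervalIntegral.integral_congr fun s _ => ?_
      ring
    · exact Continuous.intervalIntegrable (by fun_prop) _ _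
    · exact Continuous.intervalIntegrable (by fun_prop) _ _
  rw [green, integral_seg hT.le, ← i2, ← i1, ← intervalIntegral.integral_const_mul,
    ← intervalIntegral.integral_sub]
  · refine intervalIntegral.integral_congr fun s _ => ?_
    simp only [greenKernel]; ring
  · exact Continuous.intervalIntegrable (by fun_prop) _ _
  · exact Continuous.intervalIntegrable (by fun_prop) _ _

lemma hasDerivWithinAt_green (hT : 0 < T) {w : ℝ → ℝ} (hw : Continuous w) {t : ℝ}
    (ht : t ∈ Icc 0 T) : HasDerivWithinAt (green T w) (greenDeriv T w t) (Icc 0 T) t := by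
  have h1 : HasDerivAt (fun t => ∫ s in (0:ℝ)..t, w s) (w t) t := by
    exact (hw.integral_hasStrictDerivAt 0 t).hasDerivAt
  have h2 : HasDerivAt (fun t => ∫ s in (0:ℝ)..t, s * w s) (t * w t) t :=
    ((continuous_id.mul hw).integral_hasStrictDerivAt 0 t).hasDerivAt
  have h3 := ((hasDerivAt_id t).mul_const (∫ s in (0:ℝ)..T, (T - s) / T * w s)).sub
    (((hasDerivAt_id t).mul h1).sub h2)
  refine (h3.hasDerivWithinAt.congr_deriv ?_).congr (fun x hx => ?_) ?_
  · simp only [greenDeriv, id]; ring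
  · rw [green_eq hT hw hx]; rfl
  · rw [green_eq hT hw ht]; rfl

lemma hasDerivAt_greenDeriv (T : ℝ) {w : ℝ → ℝ} (hw : Continuous w) (t : ℝ) :
    HasDerivAt (greenDeriv T w) (-w t) t := by
  have h1 : HasDerivAt (fun t => ∫ s in (0:ℝ)..t, w s) (w t) t :=
    (hw.integral_hasStrictDerivAt 0 t).hasDerivAt
  exact h1.const_sub _

/-- A function whose second derivative vanishes and that is zero at both ends is zero. -/
lemma eq_zero_of_deriv2_eq_zero (hT : 0 < T) {u u' : ℝ → ℝ}
    (h : ∀ t ∈ Icc 0 T, HasDerivWithinAt u (u' t) (Icc 0 T) t)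
    (h' : ∀ t ∈ Icc 0 T, HasDerivWithinAt u' 0 (Icc 0 T) t) (h0 : u 0 = 0) (h1 : u T = 0) :
    ∀ t ∈ Icc 0 T, u t = 0 := by
  have c : ∀ t ∈ Icc 0 T, u' t = u' 0 :=
    constant_of_has_deriv_right_zero (fun t ht => (h' t ht).continuousWithinAt) fun t ht =>
      (h' t (Ico_subset_Icc_self ht)).mono_of_mem_nhdsWithin (Icc_mem_nhdsGE_of_mem ht)
  have d : ∀ t ∈ Icc 0 T, u t - u' 0 * t = u 0 - u' 0 * 0 := by
    refine constant_of_has_deriv_right_zero (f := fun t => u t - u' 0 * t)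
      (fun t ht => (h t ht).continuousWithinAt.sub (by fun_prop)) fun t ht => ?_
    have hm := Ico_subset_Icc_self ht
    have := ((h t hm).mono_of_mem_nhdsWithin (Icc_mem_nhdsGE_of_mem ht)).sub
      (((hasDerivAt_id t).const_mul (u' 0)).hasDerivWithinAt)
    refine this.congr_deriv ?_
    rw [c t hm]; simp
  have e := d T (right_mem_Icc.2 hT.le)
  rw [h0, h1] at e
  have : u' 0 = 0 := by
    have : u' 0 * T = 0 := by linarith
    exact (mul_eq_zero.1 this).resolve_right hT.ne'
  intro t ht
  have := d t ht
  rw [h0, ‹u' 0 = 0›] at this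
  linarith

lemma exists_continuous_extension {w : ℝ → ℝ} (hT : 0 < T) (hw : ContinuousOn w (Icc 0 T)) :
    ∃ w' : ℝ → ℝ, Continuous w' ∧ EqOn w' w (Icc 0 T) :=
  ⟨IccExtend hT.le (domRestrict (Icc 0 T) w), (continuousOn_iff_continuous_domRestrict.1 hw).Icc_extend',
    fun _ ht => IccExtend_of_mem hT.le _ ht⟩

/-- The difference of the two sides has vanishing second derivative and zero boundary values.
Extending `w` continuously to the line gives access to the fundamental theorem of calculus at every
point. -/
lemma eq_green (hT : 0 < T) {u u' w : ℝ → ℝ} (hw : ContinuousOn w (Icc 0 T))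
    (h : ∀ t ∈ Icc 0 T, HasDerivWithinAt u (u' t) (Icc 0 T) t)
    (h' : ∀ t ∈ Icc 0 T, HasDerivWithinAt u' (-w t) (Icc 0 T) t) (h0 : u 0 = 0) (h1 : u T = 0) :
    EqOn u (green T w) (Icc 0 T) := by
  obtain ⟨w', hc, he⟩ := exists_continuous_extension hT hw
  rw [← green_congr_on he]
  intro t ht
  refine sub_eq_zero.1 (eq_zero_of_deriv2_eq_zero hT (u := fun t => u t - green T w' t)
    (u' := fun t => u' t - greenDeriv T w' t)
    (fun s hs => (h s hs).sub (hasDerivWithinAt_green hT hc hs)) (fun s hs => ?_)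
    (by rw [h0, green_zero, sub_zero]) (by rw [h1, green_end hT, sub_zero]) t ht)
  exact ((h' s hs).sub (hasDerivAt_greenDeriv T hc s).hasDerivWithinAt).congr_deriv
    (by rw [he hs, sub_self])

end Navier

/-! ### The variational problem -/

namespace Navier
open Filter Topology

lemma memLp_seg {T : ℝ} {f : ℝ → ℝ} (hf : ContinuousOn f (Icc 0 T)) (r : ENNReal) :
    MemLp f r (segMeasure T) := by
  obtain ⟨C, hC⟩ := isCompact_Icc.exists_bound_of_continuousOn hf
  refine MemLp.of_bound (hf.aestronglyMeasurable measurableSet_Icc) C ?_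
  filter_upwards [ae_mem_seg T] with s hs using hC s hs

lemma continuous_abs_rpow {f : ℝ → ℝ} (hf : Continuous f) {r : ℝ} (hr : 0 ≤ r) :
    Continuous fun t => |f t| ^ r := hf.abs.rpow_const fun _ => Or.inr hr

lemma rpow_sub_one_mul_self {x r : ℝ} (hx : 0 ≤ x) (hr : 1 < r) : x ^ (r - 1) * x = x ^ r := by
  rcases hx.eq_or_lt with rfl | hx
  · rw [mul_zero, Real.zero_rpow (by linarith)]
  · rw [Real.rpow_sub_one hx.ne']
    field_simp

/-- The functional `∫ |G w|^q`. -/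
def energy (q T : ℝ) (w : ℝ → ℝ) : ℝ := ∫ t, |green T w t| ^ q ∂(segMeasure T)

/-- The gradient `G([G w]^{q-1})` of the functional `energy / q` at `w ≥ 0`. -/
def energyGrad (q T : ℝ) (w : ℝ → ℝ) : ℝ → ℝ := green T fun t => |green T w t| ^ (q - 1)

/-- The direction in `L^p` along which the pairing with `energyGrad` is the largest. -/
def dualDir (p' q T : ℝ) (w : ℝ → ℝ) (t : ℝ) : ℝ := |energyGrad q T w t| ^ (p' - 1)

/-- Competitors in the variational problem for the embedding constant. -/
structure Admissible (p T : ℝ) (w : ℝ → ℝ) : Prop where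
  continuous : Continuous w
  nonneg : ∀ t, 0 ≤ w t
  integral_le : ∫ t, w t ^ p ∂(segMeasure T) ≤ 1

/-- The supremum of the functional over all competitors. -/
def maxEnergy (p q T : ℝ) : ℝ := sSup (energy q T '' {w | Admissible p T w})

variable {p p' q q' T : ℝ} {w z : ℝ → ℝ}

lemma energy_nonneg (q T : ℝ) (w : ℝ → ℝ) : 0 ≤ energy q T w :=
  integral_nonneg fun _ => Real.rpow_nonneg (abs_nonneg _) _

lemma continuous_energyGrad_density (hT : 0 < T) (hq : 1 < q) (hw : Integrable w (segMeasure T)) :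
    Continuous fun t => |green T w t| ^ (q - 1) :=
  continuous_abs_rpow (continuous_green hT hw) (by linarith)

lemma continuous_energyGrad (hT : 0 < T) (hq : 1 < q) (hw : Integrable w (segMeasure T)) :
    Continuous (energyGrad q T w) :=
  continuous_green hT (integrable_seg (continuous_energyGrad_density hT hq hw).continuousOn)

lemma continuous_dualDir (hT : 0 < T) (hp : 1 < p') (hq : 1 < q)
    (hw : Integrable w (segMeasure T)) : Continuous (dualDir p' q T w) :=
  continuous_abs_rpow (continuous_energyGrad hT hq hw) (by linarith)

lemma dualDir_nonneg (p' q T : ℝ) (w : ℝ → ℝ) (t : ℝ) : 0 ≤ dualDir p' q T w t :=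
  Real.rpow_nonneg (abs_nonneg _) _

lemma energyGrad_nonneg (hT : 0 < T) (q : ℝ) (w : ℝ → ℝ) {t : ℝ} (ht : t ∈ Icc 0 T) :
    0 ≤ energyGrad q T w t :=
  green_nonneg hT (Eventually.of_forall fun _ => Real.rpow_nonneg (abs_nonneg _) _) ht

/-- Self-adjointness moves one factor `G w` onto `|G w|^{q-1}`. -/
lemma energy_eq (hT : 0 < T) (hq : 1 < q) (hw : Integrable w (segMeasure T))
    (h0 : ∀ᵐ s ∂(segMeasure T), 0 ≤ w s) :
    energy q T w = ∫ t, energyGrad q T w t * w t ∂(segMeasure T) := by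
  rw [energyGrad, ← integral_mul_green hT
    (integrable_seg (continuous_energyGrad_density hT hq hw).continuousOn) hw]
  refine integral_seg_congr fun t ht => ?_
  rw [abs_of_nonneg (green_nonneg hT h0 ht), rpow_sub_one_mul_self (green_nonneg hT h0 ht) hq]

/-- Hölder with exponents `p'`, `p`, applied to the pairing of `w` with its gradient. -/
lemma energy_le (hT : 0 < T) (hp : p.HolderConjugate p') (hq : 1 < q)
    (hw : MemLp w (ENNReal.ofReal p) (segMeasure T)) (h0 : ∀ᵐ s ∂(segMeasure T), 0 ≤ w s) :
    energy q T w ≤ (∫ t, |energyGrad q T w t| ^ p' ∂(segMeasure T)) ^ (1 / p') *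
      (∫ t, w t ^ p ∂(segMeasure T)) ^ (1 / p) := by
  have hi : Integrable w (segMeasure T) := hw.integrable (ENNReal.one_le_ofReal.2 hp.lt.le)
  rw [energy_eq hT hq hi h0]
  have := integral_mul_le_Lp_mul_Lq_of_nonneg hp.symm (μ := segMeasure T)
    (f := fun t => |energyGrad q T w t|) (g := w) (Eventually.of_forall fun _ => abs_nonneg _) h0
    (memLp_seg (continuous_energyGrad hT hq hi).abs.continuousOn _) hw
  refine le_trans (le_of_eq (integral_seg_congr fun t ht => ?_)) this
  simp only [abs_of_nonneg (energyGrad_nonneg hT q w ht)]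

/-- Hölder with exponents `q'`, `q`, after self-adjointness has moved `G` onto `z`. It is used with
`z` the dual direction of `w`, which turns a lower bound for the gradient into one for the energy of
`z`. -/
lemma integral_energyGrad_mul_le (hT : 0 < T) (hq : q.HolderConjugate q')
    (hw : Integrable w (segMeasure T)) (hz : Integrable z (segMeasure T)) :
    ∫ t, energyGrad q T w t * z t ∂(segMeasure T)
      ≤ energy q T w ^ (1 / q') * energy q T z ^ (1 / q) := by
  have hc := continuous_energyGrad_density hT hq.lt hw
  rw [energyGrad, ← integral_mul_green hT (integrable_seg hc.continuousOn) hz]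
  have hz' := continuous_green hT hz
  have h := integral_mul_le_Lp_mul_Lq_of_nonneg hq.symm (μ := segMeasure T)
    (f := fun t => |green T w t| ^ (q - 1)) (g := fun t => |green T z t|)
    (Eventually.of_forall fun _ => Real.rpow_nonneg (abs_nonneg _) _)
    (Eventually.of_forall fun _ => abs_nonneg _)
    (memLp_seg hc.continuousOn _) (memLp_seg hz'.abs.continuousOn _)
  have e : ∀ t, (|green T w t| ^ (q - 1)) ^ q' = |green T w t| ^ q := fun t => by
    rw [← Real.rpow_mul (abs_nonneg _), hq.sub_one_mul_conj]
  simp only [e] at h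
  refine le_trans (integral_mono (integrable_seg (hc.mul hz').continuousOn)
    (integrable_seg (hc.mul hz'.abs).continuousOn) fun t => ?_) h
  exact mul_le_mul_of_nonneg_left (le_abs_self _) (Real.rpow_nonneg (abs_nonneg _) _)

/-- With the next lemma: `dualDir` realizes equality in Hölder's inequality against the gradient,
since `(p' - 1) p = p'`. -/
lemma integral_dualDir_rpow (hp : p.HolderConjugate p') (q T : ℝ) (w : ℝ → ℝ) :
    ∫ t, dualDir p' q T w t ^ p ∂(segMeasure T)
      = ∫ t, |energyGrad q T w t| ^ p' ∂(segMeasure T) := by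
  refine integral_congr_ae (Eventually.of_forall fun t => ?_)
  simp only [dualDir]
  rw [← Real.rpow_mul (abs_nonneg _), hp.symm.sub_one_mul_conj]

lemma integral_energyGrad_mul_dualDir (hT : 0 < T) (hp : 1 < p') (q : ℝ) (w : ℝ → ℝ) :
    ∫ t, energyGrad q T w t * dualDir p' q T w t ∂(segMeasure T)
      = ∫ t, |energyGrad q T w t| ^ p' ∂(segMeasure T) := by
  refine integral_seg_congr fun t ht => ?_
  simp only [dualDir]
  have := energyGrad_nonneg hT q w ht
  rw [abs_of_nonneg this, mul_comm, rpow_sub_one_mul_self this hp]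

lemma green_const_mul (T a : ℝ) (w : ℝ → ℝ) (t : ℝ) :
    green T (fun s => a * w s) t = a * green T w t := by
  rw [green, green, ← integral_const_mul]
  refine integral_congr_ae (Eventually.of_forall fun s => ?_)
  simp only; ring

lemma energy_const_mul {a : ℝ} (ha : 0 ≤ a) (q T : ℝ) (w : ℝ → ℝ) :
    energy q T (fun s => a * w s) = a ^ q * energy q T w := by
  rw [energy, energy, ← integral_const_mul]
  refine integral_congr_ae (Eventually.of_forall fun s => ?_)
  simp only
  rw [green_const_mul, abs_mul, abs_of_nonneg ha, Real.mul_rpow ha (abs_nonneg _)]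

/-- From `x ≤ 1 + x^p` for `x ≥ 0`. Only uniformity over all competitors matters. -/
lemma Admissible.integral_abs_le (hT : 0 < T) (hp : 1 < p) (hw : Admissible p T w) :
    ∫ t, |w t| ∂(segMeasure T) ≤ T + 1 := by
  have hc : Continuous fun t => w t ^ p := hw.continuous.rpow_const fun _ => Or.inr (by linarith)
  have h : ∫ t, |w t| ∂(segMeasure T) ≤ ∫ t, (1 + w t ^ p) ∂(segMeasure T) := by
    refine integral_mono (integrable_seg hw.continuous.abs.continuousOn)
      (integrable_seg (continuous_const.add hc).continuousOn) fun t => ?_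
    simp only
    rw [abs_of_nonneg (hw.nonneg t)]
    rcases le_total (w t) 1 with h | h
    · linarith [Real.rpow_nonneg (hw.nonneg t) p]
    · linarith [Real.self_le_rpow_of_one_le h hp.le]
  rw [integral_add (integrable_const _) (integrable_seg hc.continuousOn)] at h
  have h1 : ∫ _, (1:ℝ) ∂(segMeasure T) = T := by
    rw [integral_seg hT.le]; simp
  linarith [hw.integral_le]

lemma bddAbove_energy (hT : 0 < T) (hp : 1 < p) (hq : 1 < q) :
    BddAbove (energy q T '' {w | Admissible p T w}) := by
  refine ⟨∫ _, ((T + 1) * T) ^ q ∂(segMeasure T), ?_⟩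
  rintro _ ⟨w, hw, rfl⟩
  have hw : Admissible p T w := hw
  have hi := integrable_seg (T := T) hw.continuous.continuousOn
  refine integral_mono_ae (integrable_seg (continuous_abs_rpow (continuous_green hT hi)
    (by linarith)).continuousOn) (integrable_const _) ?_
  filter_upwards [ae_mem_seg T] with t ht
  refine Real.rpow_le_rpow (abs_nonneg _) ((abs_green_le hT hi ht).trans ?_) (by linarith)
  exact mul_le_mul_of_nonneg_right (hw.integral_abs_le hT hp) hT.le

lemma energy_le_maxEnergy (hT : 0 < T) (hp : 1 < p) (hq : 1 < q) (hw : Admissible p T w) :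
    energy q T w ≤ maxEnergy p q T :=
  le_csSup (bddAbove_energy hT hp hq) ⟨w, hw, rfl⟩

lemma energy_pos (hT : 0 < T) (hq : 1 < q) (hw : Continuous w) (h0 : ∀ t ∈ Icc 0 T, 0 ≤ w t) {t : ℝ}
    (ht : t ∈ Icc 0 T) (hp : 0 < w t) : 0 < energy q T w := by
  have hm : T / 2 ∈ Ioo 0 T := ⟨by linarith, by linarith⟩
  have hi := integrable_seg (T := T) hw.continuousOn
  refine integral_seg_pos hT (continuous_abs_rpow (continuous_green hT hi)
    (by linarith)).continuousOn (fun _ _ => Real.rpow_nonneg (abs_nonneg _) _)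
    (Ioo_subset_Icc_self hm) ?_
  exact Real.rpow_pos_of_pos (abs_pos.2 (green_pos hT hw.continuousOn h0 ht hp hm).ne') _

lemma exists_admissible_energy_pos (hT : 0 < T) (hp : 1 < p) (hq : 1 < q) :
    ∃ w, Admissible p T w ∧ 0 < energy q T w := by
  refine ⟨fun _ => T⁻¹ ^ (1 / p), ⟨continuous_const, fun _ => ?_, le_of_eq ?_⟩, ?_⟩
  · positivity
  · rw [integral_seg hT.le]
    simp only [intervalIntegral.integral_const]
    rw [← Real.rpow_mul (by positivity), one_div_mul_cancel (by linarith), Real.rpow_one,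
      sub_zero, smul_eq_mul, mul_inv_cancel₀ hT.ne']
  · exact energy_pos hT hq continuous_const (fun _ _ => by positivity) (left_mem_Icc.2 hT.le)
      (by positivity)

lemma maxEnergy_pos (hT : 0 < T) (hp : 1 < p) (hq : 1 < q) : 0 < maxEnergy p q T := by
  obtain ⟨w, hw, h⟩ := exists_admissible_energy_pos (p := p) (q := q) hT hp hq
  exact h.trans_le (energy_le_maxEnergy hT hp hq hw)

/-- Homogeneity: normalizing `w` in `L^p` makes it a competitor. The case of zero norm is separate,
since there `w` vanishes on the segment. -/
lemma energy_le_of_continuous (hT : 0 < T) (hp : 1 < p) (hq : 1 < q) (hw : Continuous w)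
    (h0 : ∀ t, 0 ≤ w t) :
    energy q T w ≤ maxEnergy p q T * (∫ t, w t ^ p ∂(segMeasure T)) ^ (q / p) := by
  set c := ∫ t, w t ^ p ∂(segMeasure T) with hc
  have hcont : Continuous fun t => w t ^ p := hw.rpow_const fun _ => Or.inr (by linarith)
  have hc0 : 0 ≤ c := integral_nonneg fun t => Real.rpow_nonneg (h0 t) _
  rcases hc0.eq_or_lt with hz | hpos
  · have hw0 : ∀ t ∈ Icc 0 T, w t = 0 := fun t ht => by
      have := eqOn_zero_of_integral_seg_le hT hcont.continuousOn
        (fun t _ => Real.rpow_nonneg (h0 t) _) (by rw [← hc, ← hz]) ht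
      exact ((Real.rpow_eq_zero (h0 t) (by linarith)).1 this)
    rw [← hz, Real.zero_rpow (by positivity), mul_zero, energy,
      green_congr_on (w' := fun _ => 0) hw0]
    simp [green, Real.zero_rpow (show q ≠ 0 by linarith)]
  · have hk : 0 < c ^ (1 / p) := Real.rpow_pos_of_pos hpos _
    have hadm : Admissible p T fun t => (c ^ (1 / p))⁻¹ * w t := by
      refine ⟨continuous_const.mul hw, fun t => mul_nonneg (by positivity) (h0 t), le_of_eq ?_⟩
      have : ∀ t, ((c ^ (1 / p))⁻¹ * w t) ^ p = c⁻¹ * w t ^ p := fun t => by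
        rw [Real.mul_rpow (by positivity) (h0 t), Real.inv_rpow hk.le, ← Real.rpow_mul hc0,
          one_div_mul_cancel (by linarith), Real.rpow_one]
      simp only [this]
      rw [integral_const_mul, ← hc, inv_mul_cancel₀ hpos.ne']
    have h := energy_le_maxEnergy hT hp hq hadm
    rw [energy_const_mul (by positivity), Real.inv_rpow hk.le, ← Real.rpow_mul hc0,
      inv_mul_le_iff₀ (by positivity)] at h
    rwa [mul_comm, show q / p = 1 / p * q by ring]

/-- The variational inequality, for all of `L^p`. -/
lemma energy_le_of_memLp (hT : 0 < T) (hp : 1 < p) (hq : 1 < q)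
    (hw : MemLp w (ENNReal.ofReal p) (segMeasure T)) :
    energy q T w ≤ maxEnergy p q T * (∫ t, |w t| ^ p ∂(segMeasure T)) ^ (q / p) := by
  have hpp := Real.HolderConjugate.conjExponent hp
  have hqq := Real.HolderConjugate.conjExponent hq
  set p' := p.conjExponent
  set q' := q.conjExponent
  set K := maxEnergy p q T
  have hK : 0 < K := maxEnergy_pos hT hp hq
  set v := fun t => |w t| with hv
  have hvm : MemLp v (ENNReal.ofReal p) (segMeasure T) := hw.norm
  have hvi : Integrable v (segMeasure T) := hvm.integrable (ENNReal.one_le_ofReal.2 hp.le)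
  have hwi : Integrable w (segMeasure T) := hw.integrable (ENNReal.one_le_ofReal.2 hp.le)
  -- Nonnegativity of the kernel reduces the bound to `v = |w|`.
  have h1 : energy q T w ≤ energy q T v := by
    refine integral_mono_ae (integrable_seg (continuous_abs_rpow (continuous_green hT hwi)
      (by linarith)).continuousOn) (integrable_seg (continuous_abs_rpow (continuous_green hT hvi)
      (by linarith)).continuousOn) ?_
    filter_upwards [ae_mem_seg T] with t ht
    exact Real.rpow_le_rpow (abs_nonneg _) ((abs_green_le_green_abs hT w ht).trans (le_abs_self _))
      (by linarith)
  refine h1.trans ?_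
  -- `v` is only in `L^p`, so it cannot be compared with the competitors directly. Its dual
  -- direction is continuous, and the two Hölder inequalities carry the bound for the latter back to
  -- `v`.
  have h2 := energy_le hT hpp hq hvm (Eventually.of_forall fun _ => abs_nonneg _)
  have hdc := continuous_dualDir hT hpp.symm.lt hq hvi
  have h3 := integral_energyGrad_mul_le hT hqq hvi (integrable_seg (T := T) hdc.continuousOn)
  have h4 := energy_le_of_continuous hT hp hq hdc (dualDir_nonneg p' q T v)
  rw [integral_energyGrad_mul_dualDir hT hpp.symm.lt] at h3
  rw [integral_dualDir_rpow hpp] at h4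
  set E := energy q T v
  set c := ∫ t, |energyGrad q T v t| ^ p' ∂(segMeasure T)
  set N := ∫ t, v t ^ p ∂(segMeasure T)
  have hE : 0 ≤ E := energy_nonneg _ _ _
  have hc : 0 ≤ c := integral_nonneg fun _ => Real.rpow_nonneg (abs_nonneg _) _
  have hN : 0 ≤ N := integral_nonneg fun _ => Real.rpow_nonneg (abs_nonneg _) _
  have hq0 : 0 < q := by linarith
  have hp0 : 0 < p := by linarith
  rcases hE.eq_or_lt with hE0 | hEpos
  · rw [← hE0]; positivity
  have hcpos : 0 < c := by
    rcases hc.eq_or_lt with h | h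
    · rw [← h, Real.zero_rpow hpp.symm.one_div_ne_zero, zero_mul] at h2
      linarith
    · exact h
  have h5 : energy q T (dualDir p' q T v) ^ (1 / q) ≤ K ^ (1 / q) * c ^ (1 / p) := by
    refine (Real.rpow_le_rpow (energy_nonneg _ _ _) h4 (by positivity)).trans (le_of_eq ?_)
    rw [Real.mul_rpow hK.le (by positivity), ← Real.rpow_mul hc]
    congr 2
    field_simp
  -- Here `c` is both the pairing of the gradient with the dual direction and the `p`-th power of
  -- the norm of that direction; dividing by `c^{1/p}` leaves `c^{1/p'}`.
  have h6 : c ^ (1 / p') ≤ E ^ (1 / q') * K ^ (1 / q) := by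
    have : c ^ (1 / p') * c ^ (1 / p) ≤ E ^ (1 / q') * K ^ (1 / q) * c ^ (1 / p) := by
      rw [← Real.rpow_add hcpos, one_div, one_div, hpp.symm.inv_add_inv_eq_one, Real.rpow_one,
        mul_assoc]
      simp only [one_div] at h3 h5 ⊢
      exact h3.trans (mul_le_mul_of_nonneg_left h5 (by positivity))
    exact le_of_mul_le_mul_right this (by positivity)
  have h7 : E ^ (1 / q) ≤ K ^ (1 / q) * N ^ (1 / p) := by
    have : E ^ (1 / q') * E ^ (1 / q) ≤ E ^ (1 / q') * (K ^ (1 / q) * N ^ (1 / p)) := by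
      rw [← Real.rpow_add hEpos, one_div, one_div, hqq.symm.inv_add_inv_eq_one, Real.rpow_one]
      simp only [one_div] at h2 h6 ⊢
      calc E ≤ _ := h2
        _ ≤ E ^ q'⁻¹ * K ^ q⁻¹ * N ^ p⁻¹ := mul_le_mul_of_nonneg_right h6 (by positivity)
        _ = _ := by ring
    exact le_of_mul_le_mul_left this (by positivity)
  have h8 := Real.rpow_le_rpow (by positivity) h7 hq0.le
  rw [Real.mul_rpow (by positivity) (by positivity), ← Real.rpow_mul hE, ← Real.rpow_mul hK.le,
    ← Real.rpow_mul hN, one_div_mul_cancel hq0.ne', Real.rpow_one, Real.rpow_one] at h8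
  rwa [show q / p = 1 / p * q by ring]

end Navier

/-! ### Existence of maximizers and the Euler–Lagrange equation -/

namespace Navier
open Filter Topology

variable {p p' q q' T : ℝ} {w z : ℝ → ℝ}

/-- Arzelà–Ascoli: an `L^1` bound on `h n` gives a common Lipschitz constant and a common bound for
`green T (h n)`. -/
lemma exists_subseq_tendsto_green (hT : 0 < T) {h : ℕ → ℝ → ℝ} {C : ℝ}
    (hi : ∀ n, Integrable (h n) (segMeasure T)) (hC : ∀ n, ∫ s, |h n s| ∂(segMeasure T) ≤ C) :
    ∃ φ : ℕ → ℕ, StrictMono φ ∧ ∃ g : ℝ → ℝ, Continuous g ∧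
      ∀ t ∈ Icc 0 T, Tendsto (fun n => green T (h (φ n)) t) atTop (𝓝 (g t)) := by
  have hC0 : 0 ≤ C := (integral_nonneg fun _ => abs_nonneg _).trans (hC 0)
  let F : ℕ → BoundedContinuousFunction (Icc (0:ℝ) T) ℝ := fun n =>
    BoundedContinuousFunction.mkOfCompact
      ⟨fun t => green T (h n) t, (continuous_green hT (hi n)).comp continuous_subtype_val⟩
  have hLip : ∀ n, LipschitzWith C.toNNReal (F n) := fun n => by
    refine LipschitzWith.of_dist_le_mul fun t t' => ?_
    rw [Real.coe_toNNReal _ hC0]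
    exact (abs_green_sub_le hT (hi n) t t').trans
      (mul_le_mul_of_nonneg_right (hC n) (abs_nonneg _))
  have hcomp : IsCompact (closure (range F)) := by
    refine BoundedContinuousFunction.arzela_ascoli (Icc (-(C * T)) (C * T)) isCompact_Icc _ ?_ ?_
    · rintro _ t ⟨n, rfl⟩
      exact abs_le.1 ((abs_green_le hT (hi n) t.2).trans (mul_le_mul_of_nonneg_right (hC n) hT.le))
    · refine (LipschitzWith.uniformEquicontinuous _ C.toNNReal ?_).equicontinuous
      rintro ⟨_, n, rfl⟩
      exact hLip n
  obtain ⟨f, -, φ, hφ, hlim⟩ := hcomp.tendsto_subseq fun n => subset_closure (mem_range_self n)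
  refine ⟨φ, hφ, IccExtend hT.le f, f.continuous.Icc_extend', fun t ht => ?_⟩
  rw [IccExtend_of_mem hT.le f ht]
  exact ((continuous_eval_const (⟨t, ht⟩ : Icc (0:ℝ) T)).tendsto f).comp hlim

lemma tendsto_green (hT : 0 < T) {h : ℕ → ℝ → ℝ} {h' : ℝ → ℝ} {C : ℝ}
    (hm : ∀ n, Continuous (h n)) (hC : ∀ n, ∀ s ∈ Icc 0 T, |h n s| ≤ C)
    (hl : ∀ s ∈ Icc 0 T, Tendsto (fun n => h n s) atTop (𝓝 (h' s))) (t : ℝ) :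
    Tendsto (fun n => green T (h n) t) atTop (𝓝 (green T h' t)) := by
  refine tendsto_integral_of_dominated_convergence (fun _ => |t| * C)
    (fun n => ((continuous_greenKernel_right T t).mul (hm n)).aestronglyMeasurable)
    (integrable_const _) (fun n => ?_) ?_
  · filter_upwards [ae_mem_seg T] with s hs
    rw [norm_mul]
    exact mul_le_mul (abs_greenKernel_le hT t hs) (hC n s hs) (norm_nonneg _) (abs_nonneg _)
  · filter_upwards [ae_mem_seg T] with s hs
    exact (hl s hs).const_mul _

lemma tendsto_integral_abs_rpow {h : ℕ → ℝ → ℝ} {h' : ℝ → ℝ} {C r : ℝ} (hr : 0 ≤ r)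
    (hm : ∀ n, Continuous (h n)) (hC : ∀ n, ∀ s ∈ Icc 0 T, |h n s| ≤ C)
    (hl : ∀ s ∈ Icc 0 T, Tendsto (fun n => h n s) atTop (𝓝 (h' s))) :
    Tendsto (fun n => ∫ s, |h n s| ^ r ∂(segMeasure T)) atTop
      (𝓝 (∫ s, |h' s| ^ r ∂(segMeasure T))) := by
  refine tendsto_integral_of_dominated_convergence (fun _ => C ^ r)
    (fun n => (continuous_abs_rpow (hm n) hr).aestronglyMeasurable)
    (integrable_const _) (fun n => ?_) ?_
  · filter_upwards [ae_mem_seg T] with s hs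
    rw [Real.norm_of_nonneg (Real.rpow_nonneg (abs_nonneg _) _)]
    exact Real.rpow_le_rpow (abs_nonneg _) (hC n s hs) hr
  · filter_upwards [ae_mem_seg T] with s hs
    exact (hl s hs).abs.rpow_const (Or.inr hr)

/-- A maximizing sequence itself need not converge, but its gradients do along a subsequence, and
hence so do its dual directions. The maximizer is the normalized limit of the dual directions. -/
lemma exists_admissible_energy_eq (hT : 0 < T) (hp : 1 < p) (hq : 1 < q) :
    ∃ w, Admissible p T w ∧ energy q T w = maxEnergy p q T := by
  have hpp := Real.HolderConjugate.conjExponent hp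
  have hqq := Real.HolderConjugate.conjExponent hq
  set p' := p.conjExponent
  set q' := q.conjExponent
  set K := maxEnergy p q T with hKdef
  have hK : 0 < K := maxEnergy_pos hT hp hq
  obtain ⟨w₀, hw₀, -⟩ := exists_admissible_energy_pos (p := p) (q := q) hT hp hq
  obtain ⟨e, -, helim, hmem⟩ := exists_seq_tendsto_sSup
    (S := energy q T '' {w | Admissible p T w}) ⟨_, w₀, hw₀, rfl⟩ (bddAbove_energy hT hp hq)
  choose w hw hwe using hmem
  have hw : ∀ n, Admissible p T (w n) := hw
  have hwi : ∀ n, Integrable (w n) (segMeasure T) := fun n =>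
    integrable_seg (hw n).continuous.continuousOn
  set B := ((T + 1) * T) ^ (q - 1)
  have hdens : ∀ n, ∀ t ∈ Icc 0 T, |green T (w n) t| ^ (q - 1) ≤ B := fun n t ht =>
    Real.rpow_le_rpow (abs_nonneg _) ((abs_green_le hT (hwi n) ht).trans
      (mul_le_mul_of_nonneg_right ((hw n).integral_abs_le hT hp) hT.le)) (by linarith)
  have hdi : ∀ n, Integrable (fun t => |green T (w n) t| ^ (q - 1)) (segMeasure T) := fun n =>
    integrable_seg (continuous_energyGrad_density hT hq (hwi n)).continuousOn
  have hdC : ∀ n, ∫ s, |(|green T (w n) s| ^ (q - 1))| ∂(segMeasure T) ≤ T * B := fun n => by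
    have h1 : ∫ _, B ∂(segMeasure T) = T * B := by
      rw [integral_seg hT.le]; simp
    rw [← h1]
    refine integral_mono_ae (hdi n).abs (integrable_const _) ?_
    filter_upwards [ae_mem_seg T] with t ht
    rw [abs_of_nonneg (Real.rpow_nonneg (abs_nonneg _) _)]
    exact hdens n t ht
  obtain ⟨φ, hφ, g, hg, hglim⟩ := exists_subseq_tendsto_green hT hdi hdC
  have hgb : ∀ n, ∀ t ∈ Icc 0 T, |energyGrad q T (w (φ n)) t| ≤ T * B * T := fun n t ht =>
    (abs_green_le hT (hdi _) ht).trans (mul_le_mul_of_nonneg_right (hdC _) hT.le)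
  set c := ∫ t, |g t| ^ p' ∂(segMeasure T)
  have hc0 : 0 ≤ c := integral_nonneg fun _ => Real.rpow_nonneg (abs_nonneg _) _
  have hclim : Tendsto (fun n => ∫ t, |energyGrad q T (w (φ n)) t| ^ p' ∂(segMeasure T)) atTop
      (𝓝 c) :=
    tendsto_integral_abs_rpow hpp.symm.nonneg (fun n => continuous_energyGrad hT hq (hwi _)) hgb
      hglim
  set y : ℝ → ℝ := fun t => |g t| ^ (p' - 1) with hy
  have hyc : Continuous y := continuous_abs_rpow hg hpp.symm.sub_one_pos.le
  have hy0 : ∀ t, 0 ≤ y t := fun t => Real.rpow_nonneg (abs_nonneg _) _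
  have hylim : ∀ t ∈ Icc 0 T, Tendsto (fun n => dualDir p' q T (w (φ n)) t) atTop (𝓝 (y t)) :=
    fun t ht => (hglim t ht).abs.rpow_const (Or.inr hpp.symm.sub_one_pos.le)
  have hdcont : ∀ n, Continuous (dualDir p' q T (w (φ n))) := fun n =>
    continuous_dualDir hT hpp.symm.lt hq (hwi _)
  have hyb : ∀ n, ∀ t ∈ Icc 0 T, |dualDir p' q T (w (φ n)) t| ≤ (T * B * T) ^ (p' - 1) :=
    fun n t ht => by
      rw [abs_of_nonneg (dualDir_nonneg _ _ _ _ _)]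
      exact Real.rpow_le_rpow (abs_nonneg _) (hgb n t ht) hpp.symm.sub_one_pos.le
  have hdint : ∀ n, ∫ s, |dualDir p' q T (w (φ n)) s| ∂(segMeasure T)
      ≤ T * (T * B * T) ^ (p' - 1) := fun n => by
    have h1 : ∫ _, (T * B * T) ^ (p' - 1) ∂(segMeasure T) = T * (T * B * T) ^ (p' - 1) := by
      rw [integral_seg hT.le]; simp
    rw [← h1]
    refine integral_mono_ae (integrable_seg (hdcont n).continuousOn).abs (integrable_const _) ?_
    filter_upwards [ae_mem_seg T] with t ht using hyb n t ht
  have hElim : Tendsto (fun n => energy q T (dualDir p' q T (w (φ n)))) atTop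
      (𝓝 (energy q T y)) :=
    tendsto_integral_abs_rpow (C := T * (T * B * T) ^ (p' - 1) * T) (by linarith)
      (fun n => continuous_green hT (integrable_seg (hdcont n).continuousOn))
      (fun n t ht => (abs_green_le hT (integrable_seg (hdcont n).continuousOn) ht).trans
        (mul_le_mul_of_nonneg_right (hdint n) hT.le))
      (fun t _ => tendsto_green hT hdcont hyb hylim t)
  have hwlim : Tendsto (fun n => energy q T (w (φ n))) atTop (𝓝 K) := by
    simp only [hwe]
    exact helim.comp hφ.tendsto_atTop
  -- The two Hölder inequalities survive in the limit. With `k = c^{1/p}` they combine to `K k ≤ c ≤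
  -- K^{1/q'} E(y)^{1/q}`, so `y / k` has energy at least `K`.
  have hb1 : K ≤ c ^ (1 / p') := by
    refine le_of_tendsto_of_tendsto' hwlim
      (hclim.rpow_const (Or.inr hpp.symm.one_div_nonneg)) fun n => ?_
    have h := energy_le hT hpp hq (memLp_seg (hw (φ n)).continuous.continuousOn _)
      (Eventually.of_forall (hw (φ n)).nonneg)
    refine h.trans (mul_le_of_le_one_right (Real.rpow_nonneg (integral_nonneg fun _ =>
      Real.rpow_nonneg (abs_nonneg _) _) _) ?_)
    exact Real.rpow_le_one (integral_nonneg fun _ => Real.rpow_nonneg ((hw (φ n)).nonneg _) _)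
      (hw (φ n)).integral_le hpp.one_div_nonneg
  have hb2 : c ≤ K ^ (1 / q') * energy q T y ^ (1 / q) := by
    refine le_of_tendsto_of_tendsto' hclim
      ((hwlim.rpow_const (Or.inr hqq.symm.one_div_nonneg)).mul
        (hElim.rpow_const (Or.inr hqq.one_div_nonneg))) fun n => ?_
    rw [← integral_energyGrad_mul_dualDir hT hpp.symm.lt]
    exact integral_energyGrad_mul_le hT hqq (hwi _) (integrable_seg (hdcont n).continuousOn)
  have hcpos : 0 < c := by
    rcases hc0.eq_or_lt with h | h
    · rw [← h, Real.zero_rpow hpp.symm.one_div_ne_zero] at hb1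
      linarith
    · exact h
  set k := c ^ (1 / p)
  have hk : 0 < k := Real.rpow_pos_of_pos hcpos _
  have hadm : Admissible p T fun t => k⁻¹ * y t := by
    refine ⟨continuous_const.mul hyc, fun t => mul_nonneg (by positivity) (hy0 t), le_of_eq ?_⟩
    have : ∀ t, (k⁻¹ * y t) ^ p = c⁻¹ * |g t| ^ p' := fun t => by
      rw [Real.mul_rpow (by positivity) (hy0 t), Real.inv_rpow hk.le, ← Real.rpow_mul hc0,
        one_div_mul_cancel (by linarith), Real.rpow_one, ← Real.rpow_mul (abs_nonneg _),
        hpp.symm.sub_one_mul_conj]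
    simp only [this]
    rw [integral_const_mul, inv_mul_cancel₀ hcpos.ne']
  refine ⟨_, hadm, le_antisymm (energy_le_maxEnergy hT hp hq hadm) ?_⟩
  set E := energy q T y
  have hE : 0 ≤ E := energy_nonneg _ _ _
  rw [energy_const_mul (by positivity)]
  have h1 : K ^ (1 / q') * (K ^ (1 / q) * k) ≤ K ^ (1 / q') * E ^ (1 / q) := by
    rw [← mul_assoc, ← Real.rpow_add hK, one_div, one_div, hqq.symm.inv_add_inv_eq_one,
      Real.rpow_one]
    simp only [one_div] at hb2
    refine le_trans ?_ hb2
    refine (mul_le_mul_of_nonneg_right hb1 hk.le).trans (le_of_eq ?_)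
    rw [← Real.rpow_add hcpos, one_div, one_div, hpp.symm.inv_add_inv_eq_one, Real.rpow_one]
  have h2 := le_of_mul_le_mul_left h1 (by positivity)
  have h3 := Real.rpow_le_rpow (by positivity) h2 (show 0 ≤ q by linarith)
  rw [Real.mul_rpow (by positivity) hk.le, ← Real.rpow_mul hK.le, ← Real.rpow_mul hE,
    one_div_mul_cancel (by linarith), Real.rpow_one, Real.rpow_one] at h3
  rw [Real.inv_rpow hk.le, le_inv_mul_iff₀ (by positivity), mul_comm]
  exact h3

/-- The equality case in Young's inequality. -/
lemma eq_rpow_of_young_eq (hp : p.HolderConjugate p') {x y : ℝ} (hx : 0 ≤ x) (hy : 0 ≤ y)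
    (h : y ^ p / p + x ^ p' / p' - x * y = 0) : y = x ^ (p' - 1) := by
  rcases hy.eq_or_lt with rfl | hy
  · rw [Real.zero_rpow hp.ne_zero] at h
    have h1 : x ^ p' = 0 := by
      rw [zero_div, zero_add, mul_zero, sub_zero] at h
      exact (div_eq_zero_iff.1 h).resolve_right hp.symm.ne_zero
    rw [(Real.rpow_eq_zero hx hp.symm.ne_zero).1 h1, Real.zero_rpow hp.symm.sub_one_pos.ne']
  -- By Young's inequality the defect is nonnegative in `y`, so a zero is a minimum and the
  -- derivative there vanishes: `y^{p-1} = x`.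
  · have hmin : IsLocalMin (fun y => y ^ p / p + x ^ p' / p' - x * y) y := by
      filter_upwards [lt_mem_nhds hy] with z hz
      rw [h]
      have := Real.young_inequality_of_nonneg hx hz.le hp.symm
      linarith
    have hd : HasDerivAt (fun y => y ^ p / p + x ^ p' / p' - x * y)
        (p * y ^ (p - 1) / p - x * 1) y :=
      (((Real.hasDerivAt_rpow_const (Or.inl hy.ne')).div_const p).add_const _).sub
        ((hasDerivAt_id y).const_mul x)
    have h1 := hmin.hasDerivAt_eq_zero hd
    rw [mul_div_cancel_left₀ _ hp.ne_zero, mul_one, sub_eq_zero] at h1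
    rw [← h1, ← Real.rpow_mul hy.le]
    have : (p - 1) * (p' - 1) = 1 := by linarith [hp.mul_eq_add]
    rw [this, Real.rpow_one]

/-- The Euler–Lagrange equation of a maximizer. -/
lemma Admissible.euler_lagrange (hT : 0 < T) (hp : p.HolderConjugate p') (hq : 1 < q)
    (hw : Admissible p T w) (hmax : energy q T w = maxEnergy p q T) :
    (∫ t, w t ^ p ∂(segMeasure T) = 1) ∧
    ∀ t ∈ Icc 0 T, w t = (energyGrad q T w t / maxEnergy p q T) ^ (p' - 1) := by
  have hqq := Real.HolderConjugate.conjExponent hq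
  set q' := q.conjExponent
  set K := maxEnergy p q T with hKdef
  have hK : 0 < K := maxEnergy_pos hT hp.lt hq
  have hwi : Integrable w (segMeasure T) := integrable_seg hw.continuous.continuousOn
  have hdc := continuous_dualDir hT hp.symm.lt hq hwi
  have hwp : Continuous fun t => w t ^ p := hw.continuous.rpow_const fun _ => Or.inr hp.nonneg
  have hgc := continuous_energyGrad hT hq hwi
  have hgp : Continuous fun t => |energyGrad q T w t| ^ p' :=
    continuous_abs_rpow hgc hp.symm.nonneg
  have h1 := energy_le hT hp hq (memLp_seg hw.continuous.continuousOn _)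
    (Eventually.of_forall hw.nonneg)
  have h2 := integral_energyGrad_mul_le hT hqq hwi (integrable_seg (T := T) hdc.continuousOn)
  have h3 := energy_le_of_continuous hT hp.lt hq hdc (dualDir_nonneg p' q T w)
  have h4 := energy_eq hT hq hwi (Eventually.of_forall hw.nonneg)
  rw [integral_energyGrad_mul_dualDir hT hp.symm.lt] at h2
  rw [integral_dualDir_rpow hp, ← hKdef] at h3
  rw [hmax] at h1 h2 h4
  set c := ∫ t, |energyGrad q T w t| ^ p' ∂(segMeasure T) with hcdef
  set N := ∫ t, w t ^ p ∂(segMeasure T) with hNdef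
  have hc : 0 ≤ c := integral_nonneg fun _ => Real.rpow_nonneg (abs_nonneg _) _
  have hN : 0 ≤ N := integral_nonneg fun _ => Real.rpow_nonneg (hw.nonneg _) _
  have hcpos : 0 < c := by
    rcases hc.eq_or_lt with h | h
    · rw [← h, Real.zero_rpow hp.symm.one_div_ne_zero, zero_mul] at h1
      linarith
    · exact h
  have h5 : c ≤ K * c ^ (1 / p) := by
    refine h2.trans ?_
    refine (mul_le_mul_of_nonneg_left (Real.rpow_le_rpow (energy_nonneg _ _ _) h3
      hqq.one_div_nonneg) (by positivity)).trans (le_of_eq ?_)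
    rw [Real.mul_rpow hK.le (by positivity), ← mul_assoc, ← Real.rpow_add hK, one_div, one_div,
      hqq.symm.inv_add_inv_eq_one, Real.rpow_one, ← Real.rpow_mul hc, div_mul_eq_mul_div,
      mul_inv_cancel₀ (by linarith), one_div]
  have h6 : c ^ (1 / p') ≤ K := by
    have : c ^ (1 / p') * c ^ (1 / p) ≤ K * c ^ (1 / p) := by
      rwa [← Real.rpow_add hcpos, one_div, one_div, hp.symm.inv_add_inv_eq_one, Real.rpow_one,
        ← one_div]
    exact le_of_mul_le_mul_right this (by positivity)
  -- This is the bound `‖energyGrad / K‖_{p'} ≤ 1`, obtained by testing the variational inequality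
  -- on the dual direction.
  have h7 : c ≤ K ^ p' := by
    have := Real.rpow_le_rpow (by positivity) h6 hp.symm.nonneg
    rwa [← Real.rpow_mul hc, one_div_mul_cancel hp.symm.ne_zero, Real.rpow_one] at this
  have hx0 : ∀ t ∈ Icc 0 T, 0 ≤ energyGrad q T w t / K := fun t ht =>
    div_nonneg (energyGrad_nonneg hT q w ht) hK.le
  have hF : ∀ t ∈ Icc 0 T, w t ^ p / p + |energyGrad q T w t| ^ p' / K ^ p' / p'
      - energyGrad q T w t * w t / K = w t ^ p / p + (energyGrad q T w t / K) ^ p' / p'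
      - energyGrad q T w t / K * w t := fun t ht => by
    rw [abs_of_nonneg (energyGrad_nonneg hT q w ht),
      Real.div_rpow (energyGrad_nonneg hT q w ht) hK.le]
    ring
  have hFc : Continuous fun t => w t ^ p / p + |energyGrad q T w t| ^ p' / K ^ p' / p'
      - energyGrad q T w t * w t / K :=
    ((hwp.div_const p).add ((hgp.div_const _).div_const _)).sub
      ((hgc.mul hw.continuous).div_const _)
  -- The integrand is the Young defect of `energyGrad / K` and `w`. It is pointwise nonnegative, and
  -- its integral is at most `1/p + 1/p' - 1 = 0`, so the defect vanishes on the segment and both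
  -- norms are one.
  have hFi : ∫ t, (w t ^ p / p + |energyGrad q T w t| ^ p' / K ^ p' / p'
      - energyGrad q T w t * w t / K) ∂(segMeasure T) = N / p + c / K ^ p' / p' - 1 := by
    rw [integral_sub, integral_add, integral_div, integral_div, integral_div, integral_div, ← h4,
      div_self hK.ne']
    · exact integrable_seg (hwp.div_const p).continuousOn
    · exact integrable_seg ((hgp.div_const _).div_const _).continuousOn
    · exact integrable_seg ((hwp.div_const p).add ((hgp.div_const _).div_const _)).continuousOn
    · exact integrable_seg ((hgc.mul hw.continuous).div_const _).continuousOn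
  have hF0 : ∀ t ∈ Icc 0 T, 0 ≤ w t ^ p / p + |energyGrad q T w t| ^ p' / K ^ p' / p'
      - energyGrad q T w t * w t / K := fun t ht => by
    rw [hF t ht]
    linarith [Real.young_inequality_of_nonneg (hx0 t ht) (hw.nonneg t) hp.symm]
  have hFn : 0 ≤ N / p + c / K ^ p' / p' - 1 := by
    rw [← hFi]
    exact setIntegral_nonneg measurableSet_Icc hF0
  have hinv := hp.inv_add_inv_eq_one
  have hcK : c / K ^ p' / p' ≤ p'⁻¹ := by
    rw [div_eq_mul_inv _ p']
    exact mul_le_of_le_one_left hp.symm.inv_nonneg ((div_le_one (by positivity)).2 h7)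
  have hN1 : N ≤ 1 := hw.integral_le
  have hNp : N / p ≤ p⁻¹ := by
    rw [div_eq_mul_inv]
    exact mul_le_of_le_one_left hp.inv_nonneg hN1
  refine ⟨?_, fun t ht => ?_⟩
  · have : p⁻¹ ≤ N / p := by linarith
    rw [le_div_iff₀ hp.pos, inv_mul_cancel₀ hp.ne_zero] at this
    exact le_antisymm hN1 this
  · refine eq_rpow_of_young_eq hp (hx0 t ht) (hw.nonneg t) ?_
    rw [← hF t ht]
    exact eqOn_zero_of_integral_seg_le hT hFc.continuousOn hF0 (by rw [hFi]; linarith) ht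

/-! ### Dilation of the segment. -/

/-- One factor `σ` is the homogeneity of the kernel, the other comes from the change of variables.
-/
lemma green_comp_mul {σ : ℝ} (hT : 0 < T) (hσ : 0 < σ) (w : ℝ → ℝ) (t : ℝ) :
    green (σ * T) (fun s => w (s / σ)) t = σ ^ 2 * green T w (t / σ) := by
  rw [green, green, integral_seg (by positivity), integral_seg hT.le]
  have := intervalIntegral.integral_comp_div (a := 0) (b := σ * T)
    (fun s => greenKernel T (t / σ) s * w s) hσ.ne'
  rw [zero_div, mul_div_cancel_left₀ _ hσ.ne', smul_eq_mul] at this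
  rw [sq, mul_assoc, ← this, ← intervalIntegral.integral_const_mul]
  refine intervalIntegral.integral_congr fun s _ => ?_
  have e : max (t - s) 0 = σ * max (t / σ - s / σ) 0 := by
    rw [mul_max_of_nonneg _ _ hσ.le, mul_zero, mul_sub, mul_div_cancel₀ _ hσ.ne',
      mul_div_cancel₀ _ hσ.ne']
  simp only [greenKernel, e]
  field_simp

lemma integral_seg_comp_div {σ : ℝ} (hT : 0 < T) (hσ : 0 < σ) (f : ℝ → ℝ) :
    ∫ s, f (s / σ) ∂(segMeasure (σ * T)) = σ * ∫ s, f s ∂(segMeasure T) := by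
  rw [integral_seg (by positivity), integral_seg hT.le, intervalIntegral.integral_comp_div _ hσ.ne',
    zero_div, mul_div_cancel_left₀ _ hσ.ne', smul_eq_mul]

/-- Dilating a maximizer multiplies its energy by `σ^{1+2q}` and the `p`-th power of its norm by
`σ`. The inequality suffices, because applying it to `σ` and to `σ⁻¹` gives equality. -/
lemma le_maxEnergy_mul {σ : ℝ} (hT : 0 < T) (hσ : 0 < σ) (hp : 1 < p) (hq : 1 < q) :
    σ ^ (1 + 2 * q - q / p) * maxEnergy p q T ≤ maxEnergy p q (σ * T) := by
  obtain ⟨w, hw, hmax⟩ := exists_admissible_energy_eq (q := q) hT hp hq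
  have hσT : 0 < σ * T := by positivity
  have h := energy_le_of_continuous (q := q) hσT hp hq (w := fun s => w (s / σ))
    (hw.continuous.comp (continuous_id.div_const σ)) fun t => hw.nonneg _
  have e1 : energy q (σ * T) (fun s => w (s / σ)) = σ * (σ ^ (2 * q) * maxEnergy p q T) := by
    rw [energy, ← hmax, energy, ← integral_const_mul, ← integral_seg_comp_div hT hσ]
    refine integral_congr_ae (Eventually.of_forall fun t => ?_)
    simp only
    rw [green_comp_mul hT hσ, abs_mul, abs_of_nonneg (sq_nonneg σ),
      Real.mul_rpow (sq_nonneg σ) (abs_nonneg _), Real.rpow_mul hσ.le, Real.rpow_two]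
  rw [e1, integral_seg_comp_div hT hσ fun t => w t ^ p] at h
  have h2 : (σ * ∫ s, w s ^ p ∂(segMeasure T)) ^ (q / p) ≤ σ ^ (q / p) := by
    refine Real.rpow_le_rpow (mul_nonneg hσ.le (integral_nonneg fun t =>
      Real.rpow_nonneg (hw.nonneg t) _)) (mul_le_of_le_one_right hσ.le hw.integral_le) (by positivity)
  have h3 := h.trans (mul_le_mul_of_nonneg_left h2 (maxEnergy_pos hσT hp hq).le)
  rw [Real.rpow_sub hσ, Real.rpow_add hσ, Real.rpow_one, div_mul_eq_mul_div,
    div_le_iff₀ (by positivity), mul_assoc]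
  exact h3

lemma maxEnergy_eq (hT : 0 < T) (hp : 1 < p) (hq : 1 < q) :
    maxEnergy p q T = T ^ (1 + 2 * q - q / p) * maxEnergy p q 1 := by
  refine le_antisymm ?_ ?_
  · have h := le_maxEnergy_mul (p := p) (q := q) hT (inv_pos.2 hT) hp hq
    rwa [inv_mul_cancel₀ hT.ne', Real.inv_rpow hT.le, inv_mul_le_iff₀ (by positivity)] at h
  · have h := le_maxEnergy_mul (p := p) (q := q) one_pos hT hp hq
    rwa [mul_one] at h

end Navier

/-! ### Uniqueness of positive solutions of the system -/

namespace Navier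
open Filter Topology

lemma monotoneOn_of_hasDerivWithinAt_seg {F f : ℝ → ℝ} {S : ℝ}
    (h : ∀ t ∈ Icc 0 S, HasDerivWithinAt F (f t) (Icc 0 S) t) (hp : ∀ t ∈ Ioo 0 S, 0 ≤ f t) :
    MonotoneOn F (Icc 0 S) := by
  refine monotoneOn_of_hasDerivWithinAt_nonneg (f' := f) (convex_Icc _ _)
    (fun t ht => (h t ht).continuousWithinAt) ?_ ?_
  · rw [interior_Icc]
    exact fun t ht => (h t (Ioo_subset_Icc_self ht)).mono Ioo_subset_Icc_self
  · rwa [interior_Icc]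

lemma strictMonoOn_of_hasDerivWithinAt_seg {F f : ℝ → ℝ} {S : ℝ}
    (h : ∀ t ∈ Icc 0 S, HasDerivWithinAt F (f t) (Icc 0 S) t) (hp : ∀ t ∈ Ioo 0 S, 0 < f t) :
    StrictMonoOn F (Icc 0 S) := by
  refine strictMonoOn_of_hasDerivWithinAt_pos (f' := f) (convex_Icc _ _)
    (fun t ht => (h t ht).continuousWithinAt) ?_ ?_
  · rw [interior_Icc]
    exact fun t ht => (h t (Ioo_subset_Icc_self ht)).mono Ioo_subset_Icc_self
  · rwa [interior_Icc]

lemma strictAntiOn_of_hasDerivWithinAt_seg {F f : ℝ → ℝ} {S : ℝ}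
    (h : ∀ t ∈ Icc 0 S, HasDerivWithinAt F (f t) (Icc 0 S) t) (hp : ∀ t ∈ Ioo 0 S, f t < 0) :
    StrictAntiOn F (Icc 0 S) := by
  have := (strictMonoOn_of_hasDerivWithinAt_seg (F := fun t => -F t) (f := fun t => -f t)
    (fun t ht => (h t ht).neg) fun t ht => neg_pos.2 (hp t ht))
  exact fun x hx y hy hxy => neg_lt_neg_iff.1 (this hx hy hxy)

/-- A function with antitone derivative and `f 0 = 0` lies below its tangent at `0`. -/
lemma le_deriv_mul_of_antitone {f f' : ℝ → ℝ} {T : ℝ}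
    (h : ∀ t ∈ Icc 0 T, HasDerivWithinAt f (f' t) (Icc 0 T) t) (h' : AntitoneOn f' (Icc 0 T))
    (h0 : f 0 = 0) {t : ℝ} (ht : t ∈ Icc 0 T) : f t ≤ f' 0 * t := by
  have hz : (0:ℝ) ∈ Icc 0 T := ⟨le_rfl, ht.1.trans ht.2⟩
  have hm := monotoneOn_of_hasDerivWithinAt_seg (F := fun t => f' 0 * t - f t)
    (f := fun t => f' 0 * 1 - f' t)
    (fun t ht => ((hasDerivAt_id t).const_mul (f' 0)).hasDerivWithinAt.sub (h t ht))
    fun t ht => by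
      have := h' hz (Ioo_subset_Icc_self ht) ht.1.le
      linarith
  have := hm hz ht ht.1
  simp only [h0] at this
  linarith

/-- For concave `f` with `f 0 = 0` the chord slope `f t / t` is nonincreasing; the form without
division includes `t = 0`. -/
lemma mul_le_mul_of_antitone {f f' : ℝ → ℝ} {T : ℝ}
    (h : ∀ t ∈ Icc 0 T, HasDerivWithinAt f (f' t) (Icc 0 T) t) (h' : AntitoneOn f' (Icc 0 T))
    (h0 : f 0 = 0) {t s : ℝ} (ht : 0 ≤ t) (hts : t ≤ s) (hs : s ≤ T) : t * f s ≤ s * f t := by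
  rcases ht.eq_or_lt with rfl | ht
  · simp [h0]
  have hd : ∀ x ∈ Ioo 0 T, deriv f x = f' x := fun x hx =>
    ((h x (Ioo_subset_Icc_self hx)).hasDerivAt (Icc_mem_nhds hx.1 hx.2)).deriv
  have hc : ConcaveOn ℝ (Icc 0 T) f := by
    refine AntitoneOn.concaveOn_of_deriv (convex_Icc _ _)
      (fun t ht => (h t ht).continuousWithinAt) ?_ ?_
    · rw [interior_Icc]
      exact fun x hx => ((h x (Ioo_subset_Icc_self hx)).hasDerivAt
        (Icc_mem_nhds hx.1 hx.2)).differentiableAt.differentiableWithinAt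
    · rw [interior_Icc]
      intro x hx y hy hxy
      rw [hd x hx, hd y hy]
      exact h' (Ioo_subset_Icc_self hx) (Ioo_subset_Icc_self hy) hxy
  have hs0 : 0 < s := ht.trans_le hts
  have := hc.2 (show (0:ℝ) ∈ Icc 0 T from ⟨le_rfl, hs0.le.trans hs⟩)
    (show s ∈ Icc 0 T from ⟨hs0.le, hs⟩) (sub_nonneg.2 ((div_le_one hs0).2 hts))
    (show 0 ≤ t / s by positivity) (by ring)
  simp only [smul_eq_mul, mul_zero, h0, zero_add, div_mul_cancel₀ _ hs0.ne'] at this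
  rw [div_mul_eq_mul_div, div_le_iff₀ hs0] at this
  linarith

/-- Positive solutions of the system `-u'' = v^a`, `-v'' = lam u^b` on `[0, T]` with Dirichlet
boundary conditions. -/
structure IsPosSol (a b lam T : ℝ) (u u' v v' : ℝ → ℝ) : Prop where
  pos : 0 < T
  hasDeriv_u : ∀ t ∈ Icc 0 T, HasDerivWithinAt u (u' t) (Icc 0 T) t
  hasDeriv_u' : ∀ t ∈ Icc 0 T, HasDerivWithinAt u' (-(v t ^ a)) (Icc 0 T) t
  hasDeriv_v : ∀ t ∈ Icc 0 T, HasDerivWithinAt v (v' t) (Icc 0 T) t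
  hasDeriv_v' : ∀ t ∈ Icc 0 T, HasDerivWithinAt v' (-(lam * u t ^ b)) (Icc 0 T) t
  u_zero : u 0 = 0
  u_end : u T = 0
  v_zero : v 0 = 0
  v_end : v T = 0
  u_pos : ∀ t ∈ Ioo 0 T, 0 < u t
  v_pos : ∀ t ∈ Ioo 0 T, 0 < v t

namespace IsPosSol

variable {a b lam T T₁ T₂ : ℝ} {u u' v v' u₁ u₁' v₁ v₁' u₂ u₂' v₂ v₂' : ℝ → ℝ}

lemma u_nonneg (h : IsPosSol a b lam T u u' v v') {t : ℝ} (ht : t ∈ Icc 0 T) : 0 ≤ u t := by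
  rcases ht.1.eq_or_lt with rfl | h0
  · rw [h.u_zero]
  rcases ht.2.eq_or_lt with rfl | h1
  · rw [h.u_end]
  · exact (h.u_pos t ⟨h0, h1⟩).le

lemma v_nonneg (h : IsPosSol a b lam T u u' v v') {t : ℝ} (ht : t ∈ Icc 0 T) : 0 ≤ v t := by
  rcases ht.1.eq_or_lt with rfl | h0
  · rw [h.v_zero]
  rcases ht.2.eq_or_lt with rfl | h1
  · rw [h.v_end]
  · exact (h.v_pos t ⟨h0, h1⟩).le

lemma antitoneOn_u' (h : IsPosSol a b lam T u u' v v') : AntitoneOn u' (Icc 0 T) :=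
  (strictAntiOn_of_hasDerivWithinAt_seg h.hasDeriv_u'
    fun t ht => neg_neg_of_pos (Real.rpow_pos_of_pos (h.v_pos t ht) _)).antitoneOn

lemma antitoneOn_v' (h : IsPosSol a b lam T u u' v v') (hl : 0 < lam) :
    AntitoneOn v' (Icc 0 T) :=
  (strictAntiOn_of_hasDerivWithinAt_seg h.hasDeriv_v'
    fun t ht => neg_neg_of_pos (mul_pos hl (Real.rpow_pos_of_pos (h.u_pos t ht) _))).antitoneOn

lemma u'_zero_pos (h : IsPosSol a b lam T u u' v v') : 0 < u' 0 := by
  have hm : T / 2 ∈ Ioo 0 T := ⟨by linarith [h.pos], by linarith [h.pos]⟩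
  have := le_deriv_mul_of_antitone h.hasDeriv_u h.antitoneOn_u' h.u_zero (Ioo_subset_Icc_self hm)
  exact pos_of_mul_pos_left ((h.u_pos _ hm).trans_le this) hm.1.le

/-- The coupling is self-reinforcing: a larger `v'` makes `v` larger, hence `u'` and `u` smaller,
hence `v'` decreases more slowly. A gap between the slopes of `v` therefore widens and can never
close. -/
lemma comparison_aux (ha : 0 < a) (hb : 0 < b) (hl : 0 < lam)
    (h₁ : IsPosSol a b lam T₁ u₁ u₁' v₁ v₁') (h₂ : IsPosSol a b lam T₂ u₂ u₂' v₂ v₂')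
    (he : u₁' 0 = u₂' 0) {S : ℝ} (hS : 0 < S) (hS₁ : S ≤ T₁) (hS₂ : S ≤ T₂)
    (hlt : ∀ t ∈ Ioo 0 S, v₂' t < v₁' t) :
    v₂ S < v₁ S ∧ u₁ S < u₂ S ∧ v₁' 0 - v₂' 0 < v₁' S - v₂' S := by
  have s₁ : Icc 0 S ⊆ Icc 0 T₁ := Icc_subset_Icc_right hS₁
  have s₂ : Icc 0 S ⊆ Icc 0 T₂ := Icc_subset_Icc_right hS₂
  have hz : (0:ℝ) ∈ Icc 0 S := left_mem_Icc.2 hS.le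
  have hSm : S ∈ Icc 0 S := right_mem_Icc.2 hS.le
  have m1 := strictMonoOn_of_hasDerivWithinAt_seg (F := fun t => v₁ t - v₂ t)
    (f := fun t => v₁' t - v₂' t)
    (fun t ht => ((h₁.hasDeriv_v t (s₁ ht)).mono s₁).sub ((h₂.hasDeriv_v t (s₂ ht)).mono s₂))
    fun t ht => sub_pos.2 (hlt t ht)
  have c1 : ∀ t ∈ Ioc 0 S, v₂ t < v₁ t := fun t ht => by
    have := m1 hz (Ioc_subset_Icc_self ht) ht.1
    simp only [h₁.v_zero, h₂.v_zero] at this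
    linarith
  have m2 := strictAntiOn_of_hasDerivWithinAt_seg (F := fun t => u₁' t - u₂' t)
    (f := fun t => -(v₁ t ^ a) - -(v₂ t ^ a))
    (fun t ht => ((h₁.hasDeriv_u' t (s₁ ht)).mono s₁).sub ((h₂.hasDeriv_u' t (s₂ ht)).mono s₂))
    fun t ht => by
      have := Real.rpow_lt_rpow (h₂.v_nonneg (s₂ (Ioo_subset_Icc_self ht)))
        (c1 t (Ioo_subset_Ioc_self ht)) ha
      linarith
  have m3 := strictAntiOn_of_hasDerivWithinAt_seg (F := fun t => u₁ t - u₂ t)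
    (f := fun t => u₁' t - u₂' t)
    (fun t ht => ((h₁.hasDeriv_u t (s₁ ht)).mono s₁).sub ((h₂.hasDeriv_u t (s₂ ht)).mono s₂))
    fun t ht => by
      have := m2 hz (Ioo_subset_Icc_self ht) ht.1
      simp only [he] at this
      linarith
  have c3 : ∀ t ∈ Ioc 0 S, u₁ t < u₂ t := fun t ht => by
    have := m3 hz (Ioc_subset_Icc_self ht) ht.1
    simp only [h₁.u_zero, h₂.u_zero] at this
    linarith
  have m4 := strictMonoOn_of_hasDerivWithinAt_seg (F := fun t => v₁' t - v₂' t)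
    (f := fun t => -(lam * u₁ t ^ b) - -(lam * u₂ t ^ b))
    (fun t ht => ((h₁.hasDeriv_v' t (s₁ ht)).mono s₁).sub ((h₂.hasDeriv_v' t (s₂ ht)).mono s₂))
    fun t ht => by
      have := mul_lt_mul_of_pos_left (Real.rpow_lt_rpow
        (h₁.u_nonneg (s₁ (Ioo_subset_Icc_self ht))) (c3 t (Ioo_subset_Ioc_self ht)) hb) hl
      linarith
  exact ⟨c1 S ⟨hS, le_rfl⟩, c3 S ⟨hS, le_rfl⟩, m4 hz hSm hS⟩

/-- Two positive solutions with equal initial slope of `u` cannot have different initial slopes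
of `v`. -/
lemma v'_zero_le (ha : 0 < a) (hb : 0 < b) (hl : 0 < lam)
    (h₁ : IsPosSol a b lam T₁ u₁ u₁' v₁ v₁') (h₂ : IsPosSol a b lam T₂ u₂ u₂' v₂ v₂')
    (he : u₁' 0 = u₂' 0) : v₁' 0 ≤ v₂' 0 := by
  by_contra! hlt
  set S := min T₁ T₂
  have hS : 0 < S := lt_min h₁.pos h₂.pos
  have hS₁ : S ≤ T₁ := min_le_left _ _
  have hS₂ : S ≤ T₂ := min_le_right _ _
  have hD : ContinuousOn (fun t => v₁' t - v₂' t) (Icc 0 S) :=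
    ContinuousOn.sub
      (fun t ht => (h₁.hasDeriv_v' t (Icc_subset_Icc_right hS₁ ht)).continuousWithinAt.mono
        (Icc_subset_Icc_right hS₁))
      (fun t ht => (h₂.hasDeriv_v' t (Icc_subset_Icc_right hS₂ ht)).continuousWithinAt.mono
        (Icc_subset_Icc_right hS₂))
  have hpos : ∀ t ∈ Icc 0 S, v₂' t < v₁' t := by
    by_contra! hne
    set Z := Icc 0 S ∩ (fun t => v₁' t - v₂' t) ⁻¹' Iic 0 with hZ
    have hZc : IsCompact Z :=
      isCompact_Icc.of_isClosed_subset (hD.preimage_isClosed_of_isClosed isClosed_Icc isClosed_Iic)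
        inter_subset_left
    obtain ⟨t, ht, hle⟩ := hne
    -- At the first point where the slope gap closes, it would already have grown beyond its
    -- positive initial value.
    obtain ⟨s, hs, hmin⟩ := hZc.exists_isLeast ⟨t, ht, sub_nonpos.2 hle⟩
    have hs0 : v₁' s - v₂' s ≤ 0 := hs.2
    have hspos : 0 < s := by
      rcases hs.1.1.eq_or_lt with h | h
      · rw [← h] at hs0; linarith
      · exact h
    have := (comparison_aux ha hb hl h₁ h₂ he hspos (hs.1.2.trans hS₁) (hs.1.2.trans hS₂)
      fun r hr => by
        by_contra! hr'
        exact absurd (hmin ⟨⟨hr.1.le, hr.2.le.trans hs.1.2⟩, sub_nonpos.2 hr'⟩) (not_le.2 hr.2)).2.2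
    linarith
  obtain ⟨c1, c2, -⟩ := comparison_aux ha hb hl h₁ h₂ he hS hS₁ hS₂
    fun t ht => hpos t (Ioo_subset_Icc_self ht)
  -- The strict order now persists to the end of the shorter segment, where `v₁` or `u₂` vanishes,
  -- against the sign of the other solution.
  rcases le_total T₁ T₂ with h | h
  · rw [show S = T₁ from min_eq_left h, h₁.v_end] at c1
    exact absurd (h₂.v_nonneg ⟨h₁.pos.le, h⟩) (not_le.2 c1)
  · rw [show S = T₂ from min_eq_right h, h₂.u_end] at c2
    exact absurd (h₁.u_nonneg ⟨h₂.pos.le, h⟩) (not_le.2 c2)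

end IsPosSol

/-! ### Local uniqueness from the initial slopes. -/

/-- Powers are Lipschitz on cones, with constant relative to the distance to the vertex. -/
lemma exists_abs_rpow_sub_rpow_le {c C r S : ℝ} (hc : 0 < c) (hr : 0 < r) (hS : 0 ≤ S) :
    ∃ L, 0 < L ∧ ∀ t ∈ Icc 0 S, ∀ x ∈ Icc (c * t) (C * t), ∀ y ∈ Icc (c * t) (C * t), ∀ M,
      0 ≤ M → |x - y| ≤ M * t → |x ^ r - y ^ r| ≤ L * M := by
  obtain ⟨L₀, hL₀⟩ : ∃ L₀ : NNReal, LipschitzOnWith L₀ (fun x : ℝ => x ^ r) (Icc c C) := by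
    refine ContDiffOn.exists_lipschitzOnWith (n := 1) (fun x hx => ?_) one_ne_zero
      (convex_Icc _ _) isCompact_Icc
    exact (Real.contDiffAt_rpow_const_of_ne (hc.trans_le hx.1).ne').contDiffWithinAt
  -- Writing `x = t (x / t)` reduces to the interval `[c, C]` away from zero, with factor `t^r ≤
  -- S^r`. The added `1` only makes the constant positive.
  refine ⟨L₀ * S ^ r + 1, by positivity, fun t ht x hx y hy M hM hxy => ?_⟩
  rcases ht.1.eq_or_lt with h0 | h0
  · rw [← h0, mul_zero, mul_zero] at hx hy
    rw [le_antisymm hx.2 hx.1, le_antisymm hy.2 hy.1, sub_self, abs_zero]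
    positivity
  · have hx' : x / t ∈ Icc c C := ⟨(le_div_iff₀ h0).2 hx.1, (div_le_iff₀ h0).2 hx.2⟩
    have hy' : y / t ∈ Icc c C := ⟨(le_div_iff₀ h0).2 hy.1, (div_le_iff₀ h0).2 hy.2⟩
    have h1 := hL₀.dist_le_mul _ hx' _ hy'
    rw [Real.dist_eq, Real.dist_eq, ← sub_div, abs_div, abs_of_pos h0] at h1
    have h2 : |x - y| / t ≤ M := (div_le_iff₀ h0).2 hxy
    have e : ∀ z, z / t ∈ Icc c C → z ^ r = t ^ r * (z / t) ^ r := fun z hz => by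
      rw [← Real.mul_rpow h0.le (hc.le.trans hz.1), mul_div_cancel₀ _ h0.ne']
    rw [e x hx', e y hy', ← mul_sub, abs_mul, abs_of_nonneg (Real.rpow_nonneg h0.le _)]
    calc t ^ r * |(x / t) ^ r - (y / t) ^ r| ≤ S ^ r * (L₀ * M) :=
          mul_le_mul (Real.rpow_le_rpow h0.le ht.2 hr.le)
            (h1.trans (mul_le_mul_of_nonneg_left h2 L₀.2)) (abs_nonneg _) (by positivity)
      _ ≤ (L₀ * S ^ r + 1) * M := by nlinarith

/-- A pair of functions with zero Cauchy data at `0`, whose second derivatives are controlled by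
the difference quotients of one another, vanishes. -/
lemma eq_zero_of_singular_gronwall {d d' d'' e e' e'' : ℝ → ℝ} {S Λ : ℝ} (hS : 0 ≤ S) (hΛ : 0 < Λ)
    (hd : ∀ t ∈ Icc 0 S, HasDerivWithinAt d (d' t) (Icc 0 S) t)
    (hd' : ∀ t ∈ Icc 0 S, HasDerivWithinAt d' (d'' t) (Icc 0 S) t)
    (he : ∀ t ∈ Icc 0 S, HasDerivWithinAt e (e' t) (Icc 0 S) t)
    (he' : ∀ t ∈ Icc 0 S, HasDerivWithinAt e' (e'' t) (Icc 0 S) t)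
    (d0 : d 0 = 0) (d0' : d' 0 = 0) (e0 : e 0 = 0) (e0' : e' 0 = 0)
    (hde : ∀ t ∈ Icc 0 S, ∀ M, 0 ≤ M → |e t| ≤ M * t → |d'' t| ≤ Λ * M)
    (hed : ∀ t ∈ Icc 0 S, ∀ M, 0 ≤ M → |d t| ≤ M * t → |e'' t| ≤ Λ * M) :
    ∀ t ∈ Icc 0 S, d t = 0 := by
  -- Integrating `Λ N exp (L t)` gives at most `(Λ / L) N exp (L t)`. The choice `L = 4Λ` makes this
  -- `N / 4` for each of `d'` and `e'`, so the weighted maximum satisfies `N ≤ N / 2`.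
  set L := 4 * Λ with hL
  have right : ∀ {f f' : ℝ → ℝ}, (∀ t ∈ Icc 0 S, HasDerivWithinAt f (f' t) (Icc 0 S) t) →
      ∀ t ∈ Ico 0 S, HasDerivWithinAt f (f' t) (Ici t) t := fun h t ht =>
    (h t (Ico_subset_Icc_self ht)).mono_of_mem_nhdsWithin (Icc_mem_nhdsGE_of_mem ht)
  have cont : ∀ {f f' : ℝ → ℝ}, (∀ t ∈ Icc 0 S, HasDerivWithinAt f (f' t) (Icc 0 S) t) →
      ContinuousOn f (Icc 0 S) := fun h t ht => (h t ht).continuousWithinAt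
  obtain ⟨s, hs, hmax⟩ := isCompact_Icc.exists_isMaxOn ⟨0, left_mem_Icc.2 hS⟩
    (f := fun t => Real.exp (-(L * t)) * (|d' t| + |e' t|))
    ((Continuous.continuousOn (by fun_prop)).mul ((cont hd').abs.add (cont he').abs))
  set N := Real.exp (-(L * s)) * (|d' s| + |e' s|) with hN
  have hN0 : 0 ≤ N := by positivity
  have hsum : ∀ t ∈ Icc 0 S, |d' t| + |e' t| ≤ N * Real.exp (L * t) := fun t ht => by
    have h1 : Real.exp (-(L * t)) * (|d' t| + |e' t|) ≤ N := hmax ht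
    rwa [Real.exp_neg, inv_mul_le_iff₀ (Real.exp_pos _), mul_comm] at h1
  -- The factor `t` gained by the mean value inequality is exactly what the difference quotients in
  -- `hde` and `hed` require.
  have lin : ∀ {f f' : ℝ → ℝ}, (∀ t ∈ Icc 0 S, HasDerivWithinAt f (f' t) (Icc 0 S) t) →
      f 0 = 0 → (∀ t ∈ Icc 0 S, |f' t| ≤ N * Real.exp (L * t)) →
      ∀ t ∈ Icc 0 S, |f t| ≤ N * Real.exp (L * t) * t := fun {f f'} h h0 hb t ht => by
    have hsub : Icc 0 t ⊆ Icc 0 S := Icc_subset_Icc_right ht.2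
    have := norm_image_sub_le_of_norm_deriv_le_segment' (f := f) (f' := f')
      (C := N * Real.exp (L * t)) (fun x hx => (h x (hsub hx)).mono hsub) (fun x hx => ?_) t
      (right_mem_Icc.2 ht.1)
    · simpa [h0] using this
    · refine (hb x (hsub (Ico_subset_Icc_self hx))).trans (mul_le_mul_of_nonneg_left ?_ hN0)
      exact Real.exp_le_exp.2 (mul_le_mul_of_nonneg_left hx.2.le (by positivity))
  have expo : ∀ {f f' : ℝ → ℝ}, (∀ t ∈ Icc 0 S, HasDerivWithinAt f (f' t) (Icc 0 S) t) →
      f 0 = 0 → (∀ t ∈ Icc 0 S, |f' t| ≤ Λ * (N * Real.exp (L * t))) →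
      ∀ t ∈ Icc 0 S, |f t| ≤ N / 4 * Real.exp (L * t) := fun {f f'} h h0 hb t ht => by
    refine image_norm_le_of_norm_deriv_right_le_deriv_boundary (cont h) (right h)
      (B := fun t => N / 4 * Real.exp (L * t)) (B' := fun t => N / 4 * (Real.exp (L * t) * (L * 1)))
      ?_ (fun x => (((hasDerivAt_id x).const_mul L).exp.const_mul _)) (fun x hx => ?_) ht
    · simp [h0]; positivity
    · refine (hb x (Ico_subset_Icc_self hx)).trans (le_of_eq ?_)
      rw [hL]; ring
  have bd := lin hd d0 fun t ht => by linarith [hsum t ht, abs_nonneg (e' t)]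
  have be := lin he e0 fun t ht => by linarith [hsum t ht, abs_nonneg (d' t)]
  have bd' := expo hd' d0' fun t ht => hde t ht _ (by positivity) (be t ht)
  have be' := expo he' e0' fun t ht => hed t ht _ (by positivity) (bd t ht)
  have hN1 : N ≤ N / 2 := by
    have h1 : |d' s| + |e' s| ≤ N / 2 * Real.exp (L * s) := by linarith [bd' s hs, be' s hs]
    calc N = Real.exp (-(L * s)) * (|d' s| + |e' s|) := hN
      _ ≤ Real.exp (-(L * s)) * (N / 2 * Real.exp (L * s)) :=
        mul_le_mul_of_nonneg_left h1 (Real.exp_pos _).le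
      _ = N / 2 := by rw [Real.exp_neg]; field_simp
  have hNz : N = 0 := by linarith
  intro t ht
  have := bd t ht
  rw [hNz, zero_mul, zero_mul] at this
  exact abs_nonpos_iff.1 this

namespace IsPosSol

variable {a b lam T T₁ T₂ : ℝ} {u u' v v' u₁ u₁' v₁ v₁' u₂ u₂' v₂ v₂' : ℝ → ℝ}

/-- The powers may fail to be Lipschitz at `0`, where both solutions start. By concavity, however,
`u` and `v` stay in cones bounded below by a chord and above by the tangent at `0`. On such cones
the powers satisfy the bound needed for `eq_zero_of_singular_gronwall`. -/
lemma eqOn_of_slopes_eq (ha : 0 < a) (hb : 0 < b) (hl : 0 < lam)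
    (h₁ : IsPosSol a b lam T₁ u₁ u₁' v₁ v₁') (h₂ : IsPosSol a b lam T₂ u₂ u₂' v₂ v₂')
    (hu : u₁' 0 = u₂' 0) (hv : v₁' 0 = v₂' 0) {S : ℝ} (hS : 0 < S) (hS₁ : S < T₁) (hS₂ : S < T₂) :
    ∀ t ∈ Icc 0 S, u₁ t = u₂ t := by
  have s₁ : Icc 0 S ⊆ Icc 0 T₁ := Icc_subset_Icc_right hS₁.le
  have s₂ : Icc 0 S ⊆ Icc 0 T₂ := Icc_subset_Icc_right hS₂.le
  have cone : ∀ {T : ℝ} {f f' : ℝ → ℝ} {c : ℝ}, S ≤ T →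
      (∀ t ∈ Icc 0 T, HasDerivWithinAt f (f' t) (Icc 0 T) t) → AntitoneOn f' (Icc 0 T) →
      f 0 = 0 → c ≤ f S / S → ∀ t ∈ Icc 0 S, f t ∈ Icc (c * t) (f' 0 * t) :=
    fun {T f f' c} hST hf hf' h0 hc t ht => by
      refine ⟨?_, le_deriv_mul_of_antitone hf hf' h0 (Icc_subset_Icc_right hST ht)⟩
      have h1 := mul_le_mul_of_antitone hf hf' h0 ht.1 ht.2 hST
      have h2 := mul_le_mul_of_nonneg_right hc ht.1
      refine h2.trans ?_
      rw [div_mul_eq_mul_div, div_le_iff₀ hS]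
      linarith
  have pu₁ := h₁.u_pos S ⟨hS, hS₁⟩
  have pu₂ := h₂.u_pos S ⟨hS, hS₂⟩
  have pv₁ := h₁.v_pos S ⟨hS, hS₁⟩
  have pv₂ := h₂.v_pos S ⟨hS, hS₂⟩
  obtain ⟨L, hL, hLu⟩ := exists_abs_rpow_sub_rpow_le (c := min (u₁ S / S) (u₂ S / S))
    (C := u₁' 0) (S := S) (by positivity) hb hS.le
  obtain ⟨L', hL', hLv⟩ := exists_abs_rpow_sub_rpow_le (c := min (v₁ S / S) (v₂ S / S))
    (C := v₁' 0) (S := S) (by positivity) ha hS.le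
  have cu₁ := cone hS₁.le h₁.hasDeriv_u h₁.antitoneOn_u' h₁.u_zero
    (min_le_left (u₁ S / S) (u₂ S / S))
  have cu₂ := cone hS₂.le h₂.hasDeriv_u h₂.antitoneOn_u' h₂.u_zero
    (min_le_right (u₁ S / S) (u₂ S / S))
  have cv₁ := cone hS₁.le h₁.hasDeriv_v (h₁.antitoneOn_v' hl) h₁.v_zero
    (min_le_left (v₁ S / S) (v₂ S / S))
  have cv₂ := cone hS₂.le h₂.hasDeriv_v (h₂.antitoneOn_v' hl) h₂.v_zero
    (min_le_right (v₁ S / S) (v₂ S / S))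
  -- Equal initial slopes give both solutions the same upper edge of the cone.
  rw [← hu] at cu₂
  rw [← hv] at cv₂
  intro t ht
  refine sub_eq_zero.1 (eq_zero_of_singular_gronwall hS.le (Λ := max L' (lam * L))
    (d := fun t => u₁ t - u₂ t) (d' := fun t => u₁' t - u₂' t)
    (d'' := fun t => -(v₁ t ^ a) - -(v₂ t ^ a))
    (e := fun t => v₁ t - v₂ t) (e' := fun t => v₁' t - v₂' t)
    (e'' := fun t => -(lam * u₁ t ^ b) - -(lam * u₂ t ^ b)) (lt_max_of_lt_left hL')
    (fun t ht => ((h₁.hasDeriv_u t (s₁ ht)).mono s₁).sub ((h₂.hasDeriv_u t (s₂ ht)).mono s₂))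
    (fun t ht => ((h₁.hasDeriv_u' t (s₁ ht)).mono s₁).sub ((h₂.hasDeriv_u' t (s₂ ht)).mono s₂))
    (fun t ht => ((h₁.hasDeriv_v t (s₁ ht)).mono s₁).sub ((h₂.hasDeriv_v t (s₂ ht)).mono s₂))
    (fun t ht => ((h₁.hasDeriv_v' t (s₁ ht)).mono s₁).sub ((h₂.hasDeriv_v' t (s₂ ht)).mono s₂))
    (by simp [h₁.u_zero, h₂.u_zero]) (by simp [hu]) (by simp [h₁.v_zero, h₂.v_zero]) (by simp [hv])
    (fun t ht M hM h => ?_) (fun t ht M hM h => ?_) t ht)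
  · have := hLv t ht _ (cv₁ t ht) _ (cv₂ t ht) M hM h
    rw [neg_sub_neg, abs_sub_comm]
    exact this.trans (mul_le_mul_of_nonneg_right (le_max_left _ _) hM)
  · have := hLu t ht _ (cu₁ t ht) _ (cu₂ t ht) M hM h
    rw [neg_sub_neg, abs_sub_comm, ← mul_sub, abs_mul, abs_of_pos hl]
    calc _ ≤ lam * (L * M) := mul_le_mul_of_nonneg_left this hl.le
      _ = lam * L * M := by ring
      _ ≤ _ := mul_le_mul_of_nonneg_right (le_max_right _ _) hM

lemma eqOn_of_slopes_eq' (ha : 0 < a) (hb : 0 < b) (hl : 0 < lam)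
    (h₁ : IsPosSol a b lam T₁ u₁ u₁' v₁ v₁') (h₂ : IsPosSol a b lam T₂ u₂ u₂' v₂ v₂')
    (hu : u₁' 0 = u₂' 0) (hv : v₁' 0 = v₂' 0) :
    ∀ t ∈ Icc 0 (min T₁ T₂), u₁ t = u₂ t := by
  have hS : 0 < min T₁ T₂ := lt_min h₁.pos h₂.pos
  have hI : EqOn u₁ u₂ (Ico 0 (min T₁ T₂)) := fun t ht => by
    obtain ⟨S, hS1, hS2⟩ := exists_between ht.2
    exact eqOn_of_slopes_eq ha hb hl h₁ h₂ hu hv (ht.1.trans_lt hS1)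
      (hS2.trans_le (min_le_left _ _)) (hS2.trans_le (min_le_right _ _)) t ⟨ht.1, hS1.le⟩
  have c₁ : ContinuousOn u₁ (Icc 0 (min T₁ T₂)) := fun t ht =>
    ((h₁.hasDeriv_u t (Icc_subset_Icc_right (min_le_left _ _) ht)).continuousWithinAt).mono
      (Icc_subset_Icc_right (min_le_left _ _))
  have c₂ : ContinuousOn u₂ (Icc 0 (min T₁ T₂)) := fun t ht =>
    ((h₂.hasDeriv_u t (Icc_subset_Icc_right (min_le_right _ _) ht)).continuousWithinAt).mono
      (Icc_subset_Icc_right (min_le_right _ _))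
  exact hI.of_subset_closure c₁ c₂ Ico_subset_Icc_self (by rw [closure_Ico hS.ne])

/-- At the end of the shorter segment one `u` vanishes while the other would still be positive. -/
lemma length_eq_of_slopes_eq (ha : 0 < a) (hb : 0 < b) (hl : 0 < lam)
    (h₁ : IsPosSol a b lam T₁ u₁ u₁' v₁ v₁') (h₂ : IsPosSol a b lam T₂ u₂ u₂' v₂ v₂')
    (hu : u₁' 0 = u₂' 0) (hv : v₁' 0 = v₂' 0) : T₁ = T₂ := by
  have h := eqOn_of_slopes_eq' ha hb hl h₁ h₂ hu hv _
    (right_mem_Icc.2 (lt_min h₁.pos h₂.pos).le)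
  rcases lt_trichotomy T₁ T₂ with hlt | he | hlt
  · rw [min_eq_left hlt.le, h₁.u_end] at h
    exact absurd h (h₂.u_pos T₁ ⟨h₁.pos, hlt⟩).ne
  · exact he
  · rw [min_eq_right hlt.le, h₂.u_end] at h
    exact absurd h (h₁.u_pos T₂ ⟨h₂.pos, hlt⟩).ne'

/-! ### Scaling of the system and proportionality. -/

lemma rescale {s r γ lam' : ℝ} (h : IsPosSol a b lam T u u' v v') (hs : 0 < s) (hr : 0 < r)
    (hγ : 0 < γ) (e1 : s * γ ^ 2 = r ^ a) (e2 : r * γ ^ 2 * lam = s ^ b * lam') :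
    IsPosSol a b lam' (T / γ) (fun t => s * u (γ * t)) (fun t => s * γ * u' (γ * t))
      (fun t => r * v (γ * t)) (fun t => r * γ * v' (γ * t)) := by
  have maps : MapsTo (fun t => γ * t) (Icc 0 (T / γ)) (Icc 0 T) := fun t ht =>
    ⟨mul_nonneg hγ.le ht.1, (le_div_iff₀' hγ).1 ht.2⟩
  have maps' : ∀ t ∈ Ioo 0 (T / γ), γ * t ∈ Ioo 0 T := fun t ht =>
    ⟨mul_pos hγ ht.1, (lt_div_iff₀' hγ).1 ht.2⟩
  have comp : ∀ {f f' : ℝ → ℝ}, (∀ t ∈ Icc 0 T, HasDerivWithinAt f (f' t) (Icc 0 T) t) →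
      ∀ t ∈ Icc 0 (T / γ), HasDerivWithinAt (fun t => f (γ * t)) (f' (γ * t) * (γ * 1))
        (Icc 0 (T / γ)) t := fun h t ht =>
    (h (γ * t) (maps ht)).comp t ((hasDerivAt_id t).const_mul γ).hasDerivWithinAt maps
  have hend : γ * (T / γ) = T := mul_div_cancel₀ _ hγ.ne'
  refine ⟨div_pos h.pos hγ, fun t ht => ?_, fun t ht => ?_, fun t ht => ?_, fun t ht => ?_,
    by simp [h.u_zero], by simp [hend, h.u_end], by simp [h.v_zero], by simp [hend, h.v_end],
    fun t ht => mul_pos hs (h.u_pos _ (maps' t ht)),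
    fun t ht => mul_pos hr (h.v_pos _ (maps' t ht))⟩
  · exact ((comp h.hasDeriv_u t ht).const_mul s).congr_deriv (by ring)
  · refine ((comp h.hasDeriv_u' t ht).const_mul (s * γ)).congr_deriv ?_
    rw [Real.mul_rpow hr.le (h.v_nonneg (maps ht)), ← e1]
    ring
  · exact ((comp h.hasDeriv_v t ht).const_mul r).congr_deriv (by ring)
  · refine ((comp h.hasDeriv_v' t ht).const_mul (r * γ)).congr_deriv ?_
    rw [Real.mul_rpow hs.le (h.u_nonneg (maps ht))]
    linear_combination (-(u (γ * t) ^ b)) * e2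

/-- The first and third equations force `s = α / γ` and `r = (α γ)^{1/a}`. The second then becomes
`γ^{1/a + 2 + b} = α^{b - 1/a} μ`, which is solvable because the exponent of `γ` is positive. -/
lemma exists_scaling (ha : 0 < a) (hb : 0 < b) {α μ : ℝ} (hα : 0 < α) (hμ : 0 < μ) :
    ∃ s r γ : ℝ, 0 < s ∧ 0 < r ∧ 0 < γ ∧ s * γ ^ 2 = r ^ a ∧ r * γ ^ 2 = s ^ b * μ ∧
      s * γ = α := by
  set k := 1 / a + 2 + b with hk
  have hk0 : 0 < k := by positivity
  set γ := (α ^ (b - 1 / a) * μ) ^ (1 / k) with hγd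
  have hγ : 0 < γ := by positivity
  refine ⟨α / γ, (α * γ) ^ (1 / a), γ, by positivity, by positivity, hγ, ?_, ?_, ?_⟩
  · rw [← Real.rpow_mul (by positivity), one_div_mul_cancel ha.ne', Real.rpow_one]
    field_simp
  · have h1 : γ ^ (1 / a) * γ ^ 2 * γ ^ b = α ^ (b - 1 / a) * μ := by
      rw [← Real.rpow_two, ← Real.rpow_add hγ, ← Real.rpow_add hγ, ← hk, hγd,
        ← Real.rpow_mul (by positivity), one_div_mul_cancel hk0.ne', Real.rpow_one]
    rw [Real.rpow_sub hα] at h1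
    rw [Real.mul_rpow hα.le hγ.le, Real.div_rpow hα.le hγ.le]
    field_simp at h1 ⊢
    linarith
  · field_simp

/-- Positive solutions on the same segment, possibly for different `lam`, are proportional. -/
lemma exists_eq_const_mul {lam₁ lam₂ : ℝ} (ha : 0 < a) (hb : 0 < b) (hl₁ : 0 < lam₁)
    (hl₂ : 0 < lam₂) (h₁ : IsPosSol a b lam₁ T u₁ u₁' v₁ v₁')
    (h₂ : IsPosSol a b lam₂ T u₂ u₂' v₂ v₂') :
    ∃ s, 0 < s ∧ ∀ t ∈ Icc 0 T, u₁ t = s * u₂ t := by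
  -- The scaling turns `lam₂` into `lam₁` and makes the slopes of `u` at `0` agree; comparison in
  -- both directions then makes the slopes of `v` agree. Equal lengths `T = T / γ` finally give `γ =
  -- 1`.
  obtain ⟨s, r, γ, hs, hr, hγ, e1, e2, e3⟩ := exists_scaling ha hb
    (div_pos h₁.u'_zero_pos h₂.u'_zero_pos) (div_pos hl₁ hl₂)
  have h := h₂.rescale hs hr hγ e1 (lam' := lam₁) (by rw [e2]; field_simp)
  have hu : u₁' 0 = s * γ * u₂' (γ * 0) := by
    rw [mul_zero, e3, div_mul_cancel₀ _ h₂.u'_zero_pos.ne']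
  have hv := le_antisymm (v'_zero_le ha hb hl₁ h₁ h hu) (v'_zero_le ha hb hl₁ h h₁ hu.symm)
  have hT := length_eq_of_slopes_eq ha hb hl₁ h₁ h hu hv
  have hγ1 : γ = 1 := by
    rw [eq_div_iff hγ.ne'] at hT
    exact mul_left_cancel₀ h₁.pos.ne' (by rw [hT, mul_one])
  have he := eqOn_of_slopes_eq' ha hb hl₁ h₁ h hu hv
  rw [← hT, min_self] at he
  refine ⟨s, hs, fun t ht => ?_⟩
  rw [he t ht, hγ1, one_mul]

end IsPosSol
end Navier

/-! ### Representation of Sobolev functions and the embedding -/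

namespace Navier
open Filter Topology

variable {T : ℝ}

/-- Smooth functions with compact support in `(0, T)`. -/
structure IsTest (T : ℝ) (φ : ℝ → ℝ) : Prop where
  contDiff : ContDiff ℝ (⊤ : ℕ∞) φ
  compact : HasCompactSupport φ
  subset : tsupport φ ⊆ Ioo 0 T

namespace IsTest

variable {φ ψ : ℝ → ℝ}

lemma continuous (h : IsTest T φ) : Continuous φ := h.contDiff.continuous

lemma hasDerivAt (h : IsTest T φ) (t : ℝ) : HasDerivAt φ (deriv φ t) t :=
  (h.contDiff.differentiable (by simp) t).hasDerivAt

lemma deriv (h : IsTest T φ) : IsTest T (deriv φ) :=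
  ⟨(contDiff_infty_iff_deriv.1 h.contDiff).2, h.compact.deriv,
    (closure_minimal support_deriv_subset (isClosed_tsupport _)).trans h.subset⟩

lemma eq_zero (h : IsTest T φ) {t : ℝ} (ht : t ∉ Ioo 0 T) : φ t = 0 :=
  image_eq_zero_of_notMem_tsupport fun hm => ht (h.subset hm)

lemma map_zero (h : IsTest T φ) : φ 0 = 0 := h.eq_zero fun hm => lt_irrefl _ hm.1

lemma map_end (h : IsTest T φ) : φ T = 0 := h.eq_zero fun hm => lt_irrefl _ hm.2

lemma sub_const_mul (h : IsTest T φ) (h' : IsTest T ψ) (m : ℝ) :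
    IsTest T fun t => φ t - m * ψ t := by
  have hs : tsupport (fun t => φ t - m * ψ t) ⊆ tsupport φ ∪ tsupport ψ := by
    refine closure_minimal (fun t ht => ?_) ((isClosed_tsupport _).union (isClosed_tsupport _))
    by_contra hne
    rw [mem_union, not_or] at hne
    exact ht (by simp [image_eq_zero_of_notMem_tsupport hne.1,
      image_eq_zero_of_notMem_tsupport hne.2])
  refine ⟨h.contDiff.sub (contDiff_const.mul h'.contDiff), ?_, hs.trans (union_subset h.subset h'.subset)⟩
  exact (h.compact.isCompact.union h'.compact.isCompact).of_isClosed_subset (isClosed_tsupport _) hs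

lemma setIntegral_eq (h : IsTest T φ) : ∫ t, φ t ∂(segMeasure T) = ∫ t, φ t :=
  setIntegral_eq_integral_of_forall_compl_eq_zero fun _ ht =>
    h.eq_zero fun hm => ht (Ioo_subset_Icc_self hm)

/-- A test function with mean zero has a primitive which is a test function. -/
lemma exists_primitive (hT : 0 < T) (h : IsTest T ψ) (h0 : ∫ t, ψ t ∂(segMeasure T) = 0) :
    ∃ φ, IsTest T φ ∧ _root_.deriv φ = ψ := by
  obtain ⟨α, β, hα, hβ, hsub⟩ : ∃ α β, 0 < α ∧ β < T ∧ tsupport ψ ⊆ Icc α β := by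
    rcases (tsupport ψ).eq_empty_or_nonempty with he | hne
    · exact ⟨T / 2, T / 2, by linarith, by linarith, by simp [he]⟩
    · obtain ⟨α, hα⟩ := h.compact.isCompact.exists_isLeast hne
      obtain ⟨β, hβ⟩ := h.compact.isCompact.exists_isGreatest hne
      exact ⟨α, β, (h.subset hα.1).1, (h.subset hβ.1).2, fun t ht => ⟨hα.2 ht, hβ.2 ht⟩⟩
  set φ : ℝ → ℝ := fun t => ∫ s in (0:ℝ)..t, ψ s with hφ
  have hd : ∀ t, HasDerivAt φ (ψ t) t := fun t =>
    (h.continuous.integral_hasStrictDerivAt 0 t).hasDerivAt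
  have hde : _root_.deriv φ = ψ := funext fun t => (hd t).deriv
  have hz : ∀ t, t ∉ Icc α β → ψ t = 0 := fun t ht =>
    image_eq_zero_of_notMem_tsupport fun hm => ht (hsub hm)
  have hsupp : tsupport φ ⊆ Icc α β := by
    refine closure_minimal (fun t ht => ?_) isClosed_Icc
    by_contra hne
    refine ht ?_
    rw [mem_Icc, not_and_or, not_le, not_le] at hne
    rcases hne with hlt | hlt
    · rw [hφ]
      refine intervalIntegral.integral_zero_ae (Eventually.of_forall fun s hs => hz s fun hm => ?_)
      exact absurd (hs.2.trans_lt (max_lt hα hlt)) (not_lt.2 hm.1)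
    · have e : ∫ s in t..T, ψ s = 0 := by
        refine intervalIntegral.integral_zero_ae (Eventually.of_forall fun s hs => hz s fun hm => ?_)
        exact absurd ((lt_min hlt hβ).trans hs.1) (not_lt.2 hm.2)
      have := intervalIntegral.integral_add_adjacent_intervals
        (h.continuous.intervalIntegrable (μ := volume) 0 t) (h.continuous.intervalIntegrable t T)
      rw [e, add_zero, ← integral_seg hT.le, h0] at this
      exact this
  refine ⟨φ, ⟨?_, isCompact_Icc.of_isClosed_subset (isClosed_tsupport _) hsupp,
    hsupp.trans fun t ht => ⟨hα.trans_le ht.1, ht.2.trans_lt hβ⟩⟩, hde⟩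
  rw [contDiff_infty_iff_deriv, hde]
  exact ⟨fun t => (hd t).differentiableAt, h.contDiff⟩

lemma exists_integral_eq_one (hT : 0 < T) : ∃ η, IsTest T η ∧ ∫ t, η t ∂(segMeasure T) = 1 := by
  let f : ContDiffBump (T / 2) := ⟨T / 8, T / 4, by linarith, by linarith⟩
  have ht : IsTest T (f.normed volume) := by
    refine ⟨f.contDiff_normed, f.hasCompactSupport_normed, ?_⟩
    rw [f.tsupport_normed_eq, Real.closedBall_eq_Icc]
    intro t ht
    exact ⟨by linarith [ht.1, show f.rOut = T / 4 from rfl],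
      by linarith [ht.2, show f.rOut = T / 4 from rfl]⟩
  exact ⟨_, ht, by rw [ht.setIntegral_eq, f.integral_normed]⟩

/-- Integration by parts against `t`; it expresses the mean of a primitive through a first moment in
the lemma below. -/
lemma integral_eq_neg (hT : 0 < T) (h : IsTest T φ) :
    ∫ t, φ t ∂(segMeasure T) = -∫ t, t * _root_.deriv φ t ∂(segMeasure T) := by
  have h1 : ∫ t in (0:ℝ)..T, (φ t + t * _root_.deriv φ t) = 0 := by
    have hc : Continuous fun t => φ t + t * _root_.deriv φ t :=
      h.continuous.add (continuous_id.mul h.deriv.continuous)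
    rw [intervalIntegral.integral_eq_sub_of_hasDerivAt (f := fun t => t * φ t) (fun t _ => ?_)
      (hc.intervalIntegrable _ _)]
    · simp [h.map_end]
    · exact ((hasDerivAt_id t).mul (h.hasDerivAt t)).congr_deriv (by simp)
  have hi : Integrable (fun t => t * _root_.deriv φ t) (segMeasure T) :=
    integrable_seg (continuous_id.mul h.deriv.continuous).continuousOn
  rw [← integral_seg hT.le, integral_add (integrable_seg h.continuous.continuousOn) hi] at h1
  linarith

lemma green_deriv2 (hT : 0 < T) (h : IsTest T φ) {t : ℝ} (ht : t ∈ Icc 0 T) :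
    green T (_root_.deriv (_root_.deriv φ)) t = -φ t := by
  refine (eq_green hT (u := fun t => -φ t) (u' := fun t => -_root_.deriv φ t)
    h.deriv.deriv.continuous.continuousOn (fun s _ => (h.hasDerivAt s).neg.hasDerivWithinAt)
    (fun s _ => (h.deriv.hasDerivAt s).neg.hasDerivWithinAt) (by simp [h.map_zero])
    (by simp [h.map_end]) ht).symm

end IsTest

lemma integrable_mul_isTest {d φ : ℝ → ℝ} (hd : Integrable d (segMeasure T)) (hφ : IsTest T φ) :
    Integrable (fun t => d t * φ t) (segMeasure T) := by
  obtain ⟨C, hC⟩ := hφ.continuous.bounded_above_of_compact_support hφ.compact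
  exact hd.mul_bdd (c := C) hφ.continuous.aestronglyMeasurable (Eventually.of_forall hC)

lemma ae_eq_zero_of_integral_mul_isTest {d : ℝ → ℝ} (hd : Integrable d (segMeasure T))
    (h : ∀ φ, IsTest T φ → ∫ t, d t * φ t ∂(segMeasure T) = 0) : d =ᵐ[segMeasure T] 0 := by
  have hloc : LocallyIntegrableOn d (Ioo 0 T) volume :=
    (IntegrableOn.mono_set hd Ioo_subset_Icc_self).locallyIntegrableOn
  have := isOpen_Ioo.ae_eq_zero_of_integral_contDiff_smul_eq_zero hloc fun g hg hc hs => by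
    have ht : IsTest T g := ⟨hg, hc, hs⟩
    rw [← h g ht]
    rw [setIntegral_eq_integral_of_forall_compl_eq_zero]
    · simp only [smul_eq_mul, mul_comm]
    · intro t ht'
      rw [ht.eq_zero fun hm => ht' (Ioo_subset_Icc_self hm), mul_zero]
  rw [EventuallyEq, segMeasure, ← restrict_Ioo_eq_restrict_Icc, ae_restrict_iff' measurableSet_Ioo]
  exact this

/-- The du Bois-Reymond lemma of second order. -/
lemma ae_eq_affine_of_integral_mul_deriv2 (hT : 0 < T) {d : ℝ → ℝ}
    (hd : Integrable d (segMeasure T))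
    (h : ∀ φ, IsTest T φ → ∫ t, d t * deriv (deriv φ) t ∂(segMeasure T) = 0) :
    ∃ α β, d =ᵐ[segMeasure T] fun t => α + β * t := by
  obtain ⟨η, hη, hη1⟩ := IsTest.exists_integral_eq_one hT
  set A := ∫ t, d t * η t ∂(segMeasure T) with hA
  set B := ∫ t, d t * deriv η t ∂(segMeasure T) with hB
  set M := ∫ t, t * η t ∂(segMeasure T) with hM
  -- The coefficients are read off from testing `d` with `ψ - m η - c η'`, where `m` and `c` are
  -- chosen so that this is the second derivative of a test function. Here `c = m M - ∫ t ψ`.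
  refine ⟨A + M * B, -B, ?_⟩
  have haff : Integrable (fun t => A + M * B + -B * t) (segMeasure T) :=
    integrable_seg (Continuous.continuousOn (by fun_prop))
  have key := ae_eq_zero_of_integral_mul_isTest (d := fun t => d t - (A + M * B + -B * t))
    (hd.sub haff) fun ψ hψ => ?_
  · filter_upwards [key] with t ht
    exact sub_eq_zero.1 ht
  set m := ∫ t, ψ t ∂(segMeasure T) with hm
  have hψi := integrable_seg (T := T) hψ.continuous.continuousOn
  have hηi := integrable_seg (T := T) hη.continuous.continuousOn
  have htψ : Integrable (fun t => t * ψ t) (segMeasure T) :=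
    integrable_seg (continuous_id.mul hψ.continuous).continuousOn
  have htη : Integrable (fun t => t * η t) (segMeasure T) :=
    integrable_seg (continuous_id.mul hη.continuous).continuousOn
  obtain ⟨φ₁, hφ₁, e₁⟩ := (hψ.sub_const_mul hη m).exists_primitive hT (by
    rw [integral_sub hψi (hηi.const_mul _), integral_const_mul, hη1, mul_one, sub_self])
  set c := ∫ t, φ₁ t ∂(segMeasure T) with hc
  obtain ⟨φ₂, hφ₂, e₂⟩ := (hφ₁.sub_const_mul hη c).exists_primitive hT (by
    rw [integral_sub (integrable_seg hφ₁.continuous.continuousOn) (hηi.const_mul _),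
      integral_const_mul, hη1, mul_one, sub_self])
  have e₃ : deriv (deriv φ₂) = fun t => ψ t - m * η t - c * deriv η t := by
    rw [e₂]
    funext t
    have := ((hφ₁.hasDerivAt t).sub ((hη.hasDerivAt t).const_mul c)).deriv
    rw [e₁] at this
    exact this
  have hcv : c = m * M - ∫ t, t * ψ t ∂(segMeasure T) := by
    rw [hc, hφ₁.integral_eq_neg hT, e₁]
    have : ∀ t, t * (ψ t - m * η t) = t * ψ t - m * (t * η t) := fun t => by ring
    simp only [this]
    rw [integral_sub htψ (htη.const_mul _), integral_const_mul, ← hM]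
    ring
  have h0 := h φ₂ hφ₂
  rw [e₃] at h0
  have : ∀ t, d t * (ψ t - m * η t - c * deriv η t)
      = d t * ψ t - m * (d t * η t) - c * (d t * deriv η t) := fun t => by ring
  simp only [this] at h0
  rw [integral_sub, integral_sub, integral_const_mul, integral_const_mul, ← hA, ← hB] at h0
  · have h2 : ∀ t, (d t - (A + M * B + -B * t)) * ψ t
        = d t * ψ t - (A + M * B) * ψ t + B * (t * ψ t) := fun t => by ring
    simp only [h2]
    rw [integral_add, integral_sub, integral_const_mul, integral_const_mul, ← hm]
    · rw [hcv] at h0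
      linarith
    · exact integrable_mul_isTest hd hψ
    · exact hψi.const_mul _
    · exact (integrable_mul_isTest hd hψ).sub (hψi.const_mul _)
    · exact htψ.const_mul _
  · exact integrable_mul_isTest hd hψ
  · exact (integrable_mul_isTest hd hη).const_mul _
  · exact (integrable_mul_isTest hd hψ).sub ((integrable_mul_isTest hd hη).const_mul _)
  · exact (integrable_mul_isTest hd hη.deriv).const_mul _

lemma integrable_LSeg {r : ℝ} [Fact (1 < r)] (x : LSeg r T) : Integrable x (segMeasure T) :=
  (Lp.memLp x).integrable Fact.out

/-- Elements of the Sobolev space are represented by Green's function. -/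
lemma SobolevD.fn_ae_eq_green {p : ℝ} [Fact (1 < p)] (hT : 0 < T) (u : SobolevD p T) :
    u.fn =ᵐ[segMeasure T] green T fun t => -SobolevD.deriv2 u t := by
  set w : ℝ → ℝ := fun t => -SobolevD.deriv2 u t with hw
  have hui := integrable_LSeg u.fn
  have hwi : Integrable w (segMeasure T) := (integrable_LSeg (SobolevD.deriv2 u)).neg
  have hgc := continuous_green hT hwi
  have hgi := integrable_seg (T := T) hgc.continuousOn
  obtain ⟨h1, h2, c, hcc, hce, hc0, hc1⟩ := u.2
  -- Both `u` and `G w` pair with `φ''` to `∫ u'' φ`: the former by two weak integrations by parts,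
  -- the latter by self-adjointness and `G φ'' = -φ`. They thus differ by an affine function, which
  -- the boundary values force to be zero.
  obtain ⟨α, β, hab⟩ := ae_eq_affine_of_integral_mul_deriv2 hT
    (d := fun t => u.fn t - green T w t) (hui.sub hgi) fun φ hφ => by
      have e1 : ∫ t, u.fn t * deriv (deriv φ) t ∂(segMeasure T)
          = ∫ t, SobolevD.deriv2 u t * φ t ∂(segMeasure T) := by
        have a1 := h1 _ hφ.deriv.contDiff hφ.deriv.compact hφ.deriv.subset
        have a2 := h2 _ hφ.contDiff hφ.compact hφ.subset
        rw [a2, neg_neg] at a1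
        exact a1
      have e2 : ∫ t, green T w t * deriv (deriv φ) t ∂(segMeasure T)
          = ∫ t, SobolevD.deriv2 u t * φ t ∂(segMeasure T) := by
        rw [← integral_mul_green hT hwi (integrable_seg hφ.deriv.deriv.continuous.continuousOn)]
        refine integral_seg_congr fun t ht => ?_
        simp only [hφ.green_deriv2 hT ht, hw, neg_mul_neg]
      simp only [sub_mul]
      rw [integral_sub (integrable_mul_isTest hui hφ.deriv.deriv)
        (integrable_mul_isTest hgi hφ.deriv.deriv), e1, e2, sub_self]
  have hcont : ContinuousOn (fun t => |c t - green T w t - (α + β * t)|) (Icc 0 T) :=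
    ((hcc.sub hgc.continuousOn).sub (Continuous.continuousOn (by fun_prop))).abs
  have hint : ∫ t, |c t - green T w t - (α + β * t)| ∂(segMeasure T) = 0 := by
    refine integral_eq_zero_of_ae ?_
    filter_upwards [hab, hce] with t h3 h4
    have h4 : u.fn t = c t := h4
    rw [← h4, h3, sub_self, abs_zero, Pi.zero_apply]
  have hz : ∀ t ∈ Icc 0 T, c t - green T w t - (α + β * t) = 0 := fun t ht =>
    abs_eq_zero.1 (eqOn_zero_of_integral_seg_le hT hcont (fun _ _ => abs_nonneg _) hint.le ht)
  have z0 := hz 0 (left_mem_Icc.2 hT.le)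
  have z1 := hz T (right_mem_Icc.2 hT.le)
  rw [hc0, green_zero] at z0
  rw [hc1, green_end hT] at z1
  have hα : α = 0 := by linarith
  have hβ : β = 0 := by
    have : β * T = 0 := by linarith
    exact (mul_eq_zero.1 this).resolve_right hT.ne'
  filter_upwards [hce, ae_mem_seg T] with t h4 ht
  have h4 : u.fn t = c t := h4
  have := hz t ht
  rw [hα, hβ] at this
  rw [h4]
  linarith

lemma hasWeakDeriv_of_hasDerivWithinAt (hT : 0 < T) {f f' g g' : ℝ → ℝ}
    (h : ∀ t ∈ Icc 0 T, HasDerivWithinAt f (f' t) (Icc 0 T) t) (hc : ContinuousOn f' (Icc 0 T))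
    (hg : g =ᵐ[segMeasure T] f) (hg' : g' =ᵐ[segMeasure T] f') : HasWeakDeriv T g g' := by
  intro φ hφ hcs hs
  have ht : IsTest T φ := ⟨hφ, hcs, hs⟩
  have e1 : ∫ t, g t * deriv φ t ∂(segMeasure T) = ∫ t, f t * deriv φ t ∂(segMeasure T) := by
    refine integral_congr_ae ?_
    filter_upwards [hg] with t e using by rw [e]
  have e2 : ∫ t, g' t * φ t ∂(segMeasure T) = ∫ t, f' t * φ t ∂(segMeasure T) := by
    refine integral_congr_ae ?_
    filter_upwards [hg'] with t e using by rw [e]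
  rw [e1, e2, integral_seg hT.le, integral_seg hT.le,
    intervalIntegral.integral_mul_deriv_eq_deriv_mul_of_hasDerivWithinAt (u' := f')
      (v := φ)]
  · rw [ht.map_zero, ht.map_end]; ring
  · rwa [uIcc_of_le hT.le]
  · exact fun t _ => (ht.hasDerivAt t).hasDerivWithinAt
  · exact ContinuousOn.intervalIntegrable (by rwa [uIcc_of_le hT.le])
  · exact ht.deriv.continuous.intervalIntegrable _ _

/-- Twice continuously differentiable functions vanishing at the end points are in the Sobolev
space. -/
lemma SobolevD.exists_of_hasDerivWithinAt {p : ℝ} [Fact (1 < p)] (hT : 0 < T) {f f' f'' : ℝ → ℝ}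
    (h : ∀ t ∈ Icc 0 T, HasDerivWithinAt f (f' t) (Icc 0 T) t)
    (h' : ∀ t ∈ Icc 0 T, HasDerivWithinAt f' (f'' t) (Icc 0 T) t)
    (hc : ContinuousOn f'' (Icc 0 T)) (h0 : f 0 = 0) (h1 : f T = 0) :
    ∃ u : SobolevD p T, u.fn =ᵐ[segMeasure T] f ∧ SobolevD.deriv2 u =ᵐ[segMeasure T] f'' := by
  have c : ContinuousOn f (Icc 0 T) := fun t ht => (h t ht).continuousWithinAt
  have c' : ContinuousOn f' (Icc 0 T) := fun t ht => (h' t ht).continuousWithinAt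
  have m := memLp_seg c (ENNReal.ofReal p)
  have m' := memLp_seg c' (ENNReal.ofReal p)
  have m'' := memLp_seg hc (ENNReal.ofReal p)
  exact ⟨⟨(m.toLp, m'.toLp, m''.toLp),
    hasWeakDeriv_of_hasDerivWithinAt hT h c' m.coeFn_toLp m'.coeFn_toLp,
    hasWeakDeriv_of_hasDerivWithinAt hT h' hc m'.coeFn_toLp m''.coeFn_toLp,
    f, c, m.coeFn_toLp, h0, h1⟩, m.coeFn_toLp, m''.coeFn_toLp⟩

/-! ### Norms as integrals, and boundedness of the embedding. -/

lemma segNorm_eq {r : ℝ} (hr : 1 < r) {g : ℝ → ℝ} (hg : MemLp g (ENNReal.ofReal r) (segMeasure T)) :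
    segNorm r T g = (∫ t, |g t| ^ r ∂(segMeasure T)) ^ (1 / r) := by
  have h0 : 0 < r := by linarith
  rw [segNorm, hg.eLpNorm_eq_integral_rpow_norm (by simpa using h0) ENNReal.ofReal_ne_top,
    ENNReal.toReal_ofReal (Real.rpow_nonneg (integral_nonneg fun _ =>
      Real.rpow_nonneg (norm_nonneg _) _) _), ENNReal.toReal_ofReal h0.le, one_div]
  rfl

lemma norm_LSeg {r : ℝ} (x : LSeg r T) : ‖x‖ = segNorm r T x := rfl

lemma segNorm_congr {r : ℝ} {f g : ℝ → ℝ} (h : f =ᵐ[segMeasure T] g) :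
    segNorm r T f = segNorm r T g := by
  rw [segNorm, segNorm, eLpNorm_congr_ae h]

lemma segNorm_green {q : ℝ} (hT : 0 < T) (hq : 1 < q) {w : ℝ → ℝ}
    (hw : Integrable w (segMeasure T)) :
    segNorm q T (green T w) = energy q T w ^ (1 / q) :=
  segNorm_eq hq (memLp_seg (continuous_green hT hw).continuousOn _)

lemma segNorm_green_le {p q : ℝ} (hT : 0 < T) (hp : 1 < p) (hq : 1 < q) {w : ℝ → ℝ}
    (hw : MemLp w (ENNReal.ofReal p) (segMeasure T)) :
    segNorm q T (green T w) ≤ maxEnergy p q T ^ (1 / q) * segNorm p T w := by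
  have hi : Integrable w (segMeasure T) := hw.integrable (ENNReal.one_le_ofReal.2 hp.le)
  have hN : 0 ≤ ∫ t, |w t| ^ p ∂(segMeasure T) :=
    integral_nonneg fun _ => Real.rpow_nonneg (abs_nonneg _) _
  rw [segNorm_green hT hq hi, segNorm_eq hp hw]
  refine (Real.rpow_le_rpow (energy_nonneg _ _ _) (energy_le_of_memLp hT hp hq hw)
    (by positivity)).trans (le_of_eq ?_)
  rw [Real.mul_rpow (maxEnergy_pos hT hp hq).le (by positivity), ← Real.rpow_mul hN]
  congr 2
  field_simp

lemma exists_embedding {p q : ℝ} [hp : Fact (1 < p)] [hq : Fact (1 < q)] (hT : 0 < T) :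
    ∃ E : SobolevD p T →L[ℝ] LSeg q T, (∀ u, E u =ᵐ[segMeasure T] u.fn) ∧
      ‖E‖ ≤ maxEnergy p q T ^ (1 / q) := by
  -- The Green representative is continuous, so the class lies in `L^q` whatever the order of `p`
  -- and `q`.
  have hmem : ∀ u : SobolevD p T, MemLp u.fn (ENNReal.ofReal q) (segMeasure T) := fun u =>
    (memLp_congr_ae (u.fn_ae_eq_green hT)).2 (memLp_seg (continuous_green hT
      (integrable_LSeg (SobolevD.deriv2 u)).neg).continuousOn _)
  let L : SobolevD p T →ₗ[ℝ] LSeg q T :=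
    { toFun := fun u => (hmem u).toLp
      map_add' := fun u v => by
        refine Lp.ext ?_
        have h : (u + v).fn = u.fn + v.fn := rfl
        filter_upwards [(hmem (u + v)).coeFn_toLp, (hmem u).coeFn_toLp, (hmem v).coeFn_toLp,
          Lp.coeFn_add (hmem u).toLp (hmem v).toLp, Lp.coeFn_add u.fn v.fn] with t h1 h2 h3 h4 h5
        rw [h1, h4, Pi.add_apply, h2, h3, h, h5, Pi.add_apply]
      map_smul' := fun a u => by
        refine Lp.ext ?_
        have h : (a • u).fn = a • u.fn := rfl
        filter_upwards [(hmem (a • u)).coeFn_toLp, (hmem u).coeFn_toLp,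
          Lp.coeFn_smul a (hmem u).toLp, Lp.coeFn_smul a u.fn] with t h1 h2 h3 h4
        rw [h1, RingHom.id_apply, h3, Pi.smul_apply, h2, h, h4, Pi.smul_apply] }
  refine ⟨L.mkContinuous (maxEnergy p q T ^ (1 / q)) fun u => ?_,
    fun u => (hmem u).coeFn_toLp, L.mkContinuous_norm_le (Real.rpow_nonneg
      (maxEnergy_pos hT hp.out hq.out).le _) _⟩
  have h := segNorm_green_le hT hp.out hq.out (Lp.memLp (SobolevD.deriv2 u)).neg
  have e : segNorm p T (-SobolevD.deriv2 u : ℝ → ℝ) = ‖u‖ := by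
    rw [segNorm, eLpNorm_neg]; rfl
  rw [e] at h
  refine le_trans (le_of_eq ?_) h
  rw [norm_LSeg]
  exact segNorm_congr ((hmem u).coeFn_toLp.trans (u.fn_ae_eq_green hT))

end Navier

/-! ### Spectral couples -/

namespace Navier
open Filter Topology

variable {T p p' q q' lam mu : ℝ} {f g u : ℝ → ℝ}

lemma signedPow_mul_self {r : ℝ} (hr : 1 < r) (x : ℝ) : signedPow r x * x = |x| ^ r := by
  rw [signedPow, mul_assoc, ← abs_mul_abs_self x, ← mul_assoc]
  rcases (abs_nonneg x).eq_or_lt with h | h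
  · simp [← h, Real.zero_rpow (show r ≠ 0 by linarith)]
  · rw [← Real.rpow_add_one h.ne', ← Real.rpow_add_one h.ne']
    ring_nf

lemma signedPow_of_nonneg {r x : ℝ} (hr : 1 < r) (hx : 0 ≤ x) : signedPow r x = x ^ (r - 1) := by
  rw [signedPow, abs_of_nonneg hx]
  rcases hx.eq_or_lt with h | h
  · rw [← h, mul_zero, Real.zero_rpow (by linarith)]
  · rw [← Real.rpow_add_one h.ne']
    ring_nf

lemma signedPow_neg (r x : ℝ) : signedPow r (-x) = -signedPow r x := by
  rw [signedPow, signedPow, abs_neg, mul_neg]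

lemma eq_neg_rpow_of_signedPow_eq (hp : p.HolderConjugate p') {x y : ℝ} (hy : 0 ≤ y)
    (h : signedPow p x = -y) : x = -(y ^ (p' - 1)) := by
  have hx : 0 ≤ -x := by
    by_contra! hx
    have : 0 < signedPow p x :=
      mul_pos (Real.rpow_pos_of_pos (abs_pos.2 (by linarith)) _) (by linarith)
    linarith
  have h1 : (-x) ^ (p - 1) = y := by
    rw [← signedPow_of_nonneg hp.lt hx, signedPow_neg, h, neg_neg]
  rw [← h1, ← Real.rpow_mul hx]
  have : (p - 1) * (p' - 1) = 1 := by linarith [hp.mul_eq_add]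
  rw [this, Real.rpow_one, neg_neg]

lemma hasDerivWithinAt_segDeriv (hT : 0 < T) (hf : ContDiffOn ℝ 2 f (Icc 0 T)) :
    (∀ t ∈ Icc 0 T, HasDerivWithinAt f (segDeriv T f t) (Icc 0 T) t) ∧
    (∀ t ∈ Icc 0 T, HasDerivWithinAt (segDeriv T f) (segDeriv2 T f t) (Icc 0 T) t) ∧
    ContinuousOn (segDeriv2 T f) (Icc 0 T) := by
  have hu := uniqueDiffOn_Icc hT
  have h1 : ContDiffOn ℝ 1 (segDeriv T f) (Icc 0 T) := hf.derivWithin hu (by norm_num)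
  have h2 : ContDiffOn ℝ 0 (segDeriv2 T f) (Icc 0 T) := h1.derivWithin hu (by norm_num)
  exact ⟨fun t ht => (hf.differentiableOn (by norm_num) t ht).hasDerivWithinAt,
    fun t ht => (h1.differentiableOn (by norm_num) t ht).hasDerivWithinAt, h2.continuousOn⟩

section HasDeriv

variable {f' f'' : ℝ → ℝ}

lemma segDeriv_eq (hT : 0 < T) (h : ∀ t ∈ Icc 0 T, HasDerivWithinAt f (f' t) (Icc 0 T) t) :
    EqOn (segDeriv T f) f' (Icc 0 T) := fun t ht =>
  (h t ht).derivWithin (uniqueDiffOn_Icc hT t ht)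

lemma segDeriv2_eq (hT : 0 < T) (h : ∀ t ∈ Icc 0 T, HasDerivWithinAt f (f' t) (Icc 0 T) t)
    (h' : ∀ t ∈ Icc 0 T, HasDerivWithinAt f' (f'' t) (Icc 0 T) t) :
    EqOn (segDeriv2 T f) f'' (Icc 0 T) :=
  segDeriv_eq hT fun t ht => (h' t ht).congr (segDeriv_eq hT h) (segDeriv_eq hT h ht)

lemma contDiffOn_two (hT : 0 < T) (h : ∀ t ∈ Icc 0 T, HasDerivWithinAt f (f' t) (Icc 0 T) t)
    (h' : ∀ t ∈ Icc 0 T, HasDerivWithinAt f' (f'' t) (Icc 0 T) t)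
    (hc : ContinuousOn f'' (Icc 0 T)) : ContDiffOn ℝ 2 f (Icc 0 T) := by
  have hu := uniqueDiffOn_Icc hT
  have h1 : ContDiffOn ℝ 1 f' (Icc 0 T) := by
    rw [show (1 : WithTop ℕ∞) = 0 + 1 by norm_num, contDiffOn_succ_iff_derivWithin hu]
    refine ⟨fun t ht => (h' t ht).differentiableWithinAt, by simp, ?_⟩
    rw [contDiffOn_zero]
    exact hc.congr (segDeriv_eq hT h')
  rw [show (2 : WithTop ℕ∞) = 1 + 1 by norm_num, contDiffOn_succ_iff_derivWithin hu]
  exact ⟨fun t ht => (h t ht).differentiableWithinAt, by simp, h1.congr (segDeriv_eq hT h)⟩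

end HasDeriv

namespace IsEigenpair

lemma eqOn_green (hT : 0 < T) (h : IsEigenpair p q T u lam) :
    EqOn u (green T fun t => -segDeriv2 T u t) (Icc 0 T) := by
  obtain ⟨h1, h2, h3⟩ := hasDerivWithinAt_segDeriv hT h.contDiffOn
  exact eq_green hT h3.neg h1 (fun t ht => by simpa using h2 t ht) h.left h.right

lemma pow_eqOn_green (hT : 0 < T) (h : IsEigenpair p q T u lam) :
    EqOn (fun t => -signedPow p (segDeriv2 T u t)) (green T fun t => lam * signedPow q (u t))
      (Icc 0 T) := by
  obtain ⟨h1, h2, h3⟩ := hasDerivWithinAt_segDeriv hT h.contDiffOn_pow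
  have hz : signedPow p 0 = 0 := by simp [signedPow]
  refine eq_green hT (h3.congr fun t ht => (h.equation t ht).symm) (fun t ht => (h1 t ht).neg)
    (fun t ht => ?_) (by simp [h.left_deriv2, hz]) (by simp [h.right_deriv2, hz])
  rw [← h.equation t ht]
  exact (h2 t ht).neg

/-- The Rayleigh identity: pair `λ [u]^{q-1}` with `u = G(-u'')` and use `-[u'']^{p-1} = G(λ
[u]^{q-1})` and self-adjointness in place of integrating by parts. -/
lemma mul_integral_eq (hT : 0 < T) (hp : 1 < p) (hq : 1 < q) (h : IsEigenpair p q T u lam) :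
    lam * ∫ t, |u t| ^ q ∂(segMeasure T) = ∫ t, |segDeriv2 T u t| ^ p ∂(segMeasure T) := by
  have hc := (hasDerivWithinAt_segDeriv hT h.contDiffOn).2.2
  have hc' : ContinuousOn (fun t => lam * signedPow q (u t)) (Icc 0 T) :=
    (hasDerivWithinAt_segDeriv hT h.contDiffOn_pow).2.2.congr fun t ht => (h.equation t ht).symm
  have key := integral_mul_green hT (integrable_seg hc') (integrable_seg hc.neg)
  have e1 : ∫ t, lam * signedPow q (u t) * green T (fun t => -segDeriv2 T u t) t ∂(segMeasure T)
      = ∫ t, lam * |u t| ^ q ∂(segMeasure T) := integral_seg_congr fun t ht => by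
    rw [← h.eqOn_green hT ht, mul_assoc, signedPow_mul_self hq]
  have e2 : ∫ t, green T (fun t => lam * signedPow q (u t)) t * -segDeriv2 T u t ∂(segMeasure T)
      = ∫ t, |segDeriv2 T u t| ^ p ∂(segMeasure T) := integral_seg_congr fun t ht => by
    rw [← h.pow_eqOn_green hT ht, neg_mul_neg, signedPow_mul_self hp]
  rw [← integral_const_mul, ← e1, ← e2]
  exact key

end IsEigenpair

namespace IsSpectralCouple

lemma integral_deriv2 (hT : 0 < T) (hp : 1 < p) (h : IsSpectralCouple p q T f lam) :
    ∫ t, |segDeriv2 T f t| ^ p ∂(segMeasure T) = 1 := by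
  have hc := (hasDerivWithinAt_segDeriv hT h.eigenpair.contDiffOn).2.2
  have hn := h.norm_deriv2
  rw [segNorm_eq hp (memLp_seg hc _)] at hn
  have h0 : 0 ≤ ∫ t, |segDeriv2 T f t| ^ p ∂(segMeasure T) :=
    integral_nonneg fun _ => Real.rpow_nonneg (abs_nonneg _) _
  have := congrArg (fun x : ℝ => x ^ p) hn
  simpa only [← Real.rpow_mul h0, one_div_mul_cancel (show p ≠ 0 by linarith), Real.rpow_one,
    Real.one_rpow] using this

lemma mul_integral_eq_one (hT : 0 < T) (hp : 1 < p) (hq : 1 < q)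
    (h : IsSpectralCouple p q T f lam) : lam * ∫ t, |f t| ^ q ∂(segMeasure T) = 1 := by
  rw [h.eigenpair.mul_integral_eq hT hp hq, h.integral_deriv2 hT hp]

/-- The variational bound for `-f''` of unit norm, combined with `λ ∫ |f|^q = 1`. -/
lemma inv_maxEnergy_le (hT : 0 < T) (hp : 1 < p) (hq : 1 < q)
    (h : IsSpectralCouple p q T f lam) : (maxEnergy p q T)⁻¹ ≤ lam := by
  have hc := (hasDerivWithinAt_segDeriv hT h.eigenpair.contDiffOn).2.2
  have h1 := energy_le_of_memLp hT hp hq (memLp_seg hc.neg (ENNReal.ofReal p))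
  have e : ∫ t, |(-segDeriv2 T f) t| ^ p ∂(segMeasure T) = 1 := by
    simp only [Pi.neg_apply, abs_neg]
    exact h.integral_deriv2 hT hp
  have e' : energy q T (-segDeriv2 T f) = ∫ t, |f t| ^ q ∂(segMeasure T) :=
    integral_seg_congr fun t ht => by
      have := h.eigenpair.eqOn_green hT ht
      rw [this]
      rfl
  rw [e, e', Real.one_rpow, mul_one] at h1
  have h2 := h.mul_integral_eq_one hT hp hq
  rw [inv_le_iff_one_le_mul₀ (maxEnergy_pos hT hp hq), ← h2]
  exact mul_le_mul_of_nonneg_left h1 h.eigenpair.pos.le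

end IsSpectralCouple

namespace IsFirstSpectralCouple

/-- Without interior zeros the sign is constant, and a nonpositive function starting at `0` cannot
have `f'(0) > 0`. -/
lemma pos (hT : 0 < T) (h : IsFirstSpectralCouple p q T f lam) : ∀ t ∈ Ioo 0 T, 0 < f t := by
  obtain ⟨h1, -, -⟩ := hasDerivWithinAt_segDeriv hT h.couple.eigenpair.contDiffOn
  have hc : ContinuousOn f (Icc 0 T) := h.couple.eigenpair.contDiffOn.continuousOn
  by_contra! hne
  obtain ⟨t, ht, hle⟩ := hne
  have hneg : ∀ s ∈ Ioo 0 T, f s ≤ 0 := fun s hs => by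
    by_contra! hs'
    obtain ⟨r, hr, hr0⟩ := isPreconnected_Ioo.intermediate_value ht hs
      (hc.mono Ioo_subset_Icc_self) ⟨hle, hs'.le⟩
    exact h.ne_zero r hr hr0
  have hd := (h1 0 (left_mem_Icc.2 hT.le)).mono Ioo_subset_Icc_self
  rw [hasDerivWithinAt_iff_tendsto_slope' (fun hm => lt_irrefl _ hm.1)] at hd
  have : (𝓝[Ioo 0 T] (0:ℝ)).NeBot := by
    rw [nhdsWithin_Ioo_eq_nhdsGT hT]; infer_instance
  have := le_of_tendsto hd (b := 0) (by
    filter_upwards [self_mem_nhdsWithin] with s hs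
    rw [slope_def_field, h.couple.eigenpair.left, sub_zero, sub_zero]
    exact div_nonpos_of_nonpos_of_nonneg (hneg s hs) hs.1.le)
  exact absurd h.couple.deriv_zero_pos (not_lt.2 this)

/-- Setting `v = -[f'']^{p-1}` splits the fourth-order equation into the system. `v` is positive
inside since it is `G` of a nonnegative function that is not identically zero. -/
lemma isPosSol (hT : 0 < T) (hp : p.HolderConjugate p') (hq : 1 < q)
    (h : IsFirstSpectralCouple p q T f lam) :
    IsPosSol (p' - 1) (q - 1) lam T f (segDeriv T f)
      (fun t => -signedPow p (segDeriv2 T f t))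
      (fun t => -segDeriv T (fun s => signedPow p (segDeriv2 T f s)) t) := by
  have he := h.couple.eigenpair
  obtain ⟨h1, h2, -⟩ := hasDerivWithinAt_segDeriv hT he.contDiffOn
  obtain ⟨k1, k2, k3⟩ := hasDerivWithinAt_segDeriv hT he.contDiffOn_pow
  have hz : signedPow p 0 = 0 := by simp [signedPow]
  have hf0 : ∀ t ∈ Icc 0 T, 0 ≤ f t := fun t ht => by
    rcases ht.1.eq_or_lt with rfl | ht0
    · rw [he.left]
    rcases ht.2.eq_or_lt with rfl | ht1
    · rw [he.right]
    · exact (h.pos hT t ⟨ht0, ht1⟩).le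
  have hpow : ∀ t ∈ Icc 0 T, signedPow q (f t) = f t ^ (q - 1) := fun t ht =>
    signedPow_of_nonneg hq (hf0 t ht)
  have hvpos : ∀ t ∈ Ioo 0 T, 0 < -signedPow p (segDeriv2 T f t) := fun t ht => by
    have hm : T / 2 ∈ Ioo 0 T := ⟨by linarith, by linarith⟩
    have hgr := he.pow_eqOn_green hT (Ioo_subset_Icc_self ht)
    simp only at hgr
    rw [hgr]
    refine green_pos hT (k3.congr fun t ht => (he.equation t ht).symm) (fun s hs => ?_)
      (Ioo_subset_Icc_self hm) ?_ ht
    · rw [hpow s hs]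
      exact mul_nonneg he.pos.le (Real.rpow_nonneg (hf0 s hs) _)
    · rw [hpow _ (Ioo_subset_Icc_self hm)]
      exact mul_pos he.pos (Real.rpow_pos_of_pos (h.pos hT _ hm) _)
  have hv0 : ∀ t ∈ Icc 0 T, 0 ≤ -signedPow p (segDeriv2 T f t) := fun t ht => by
    rcases ht.1.eq_or_lt with rfl | ht0
    · rw [he.left_deriv2, hz, neg_zero]
    rcases ht.2.eq_or_lt with rfl | ht1
    · rw [he.right_deriv2, hz, neg_zero]
    · exact (hvpos t ⟨ht0, ht1⟩).le
  refine ⟨hT, h1, fun t ht => ?_, fun t ht => (k1 t ht).neg, fun t ht => ?_, he.left, he.right,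
    by rw [he.left_deriv2, hz, neg_zero], by rw [he.right_deriv2, hz, neg_zero], h.pos hT, hvpos⟩
  · exact (h2 t ht).congr_deriv
      (eq_neg_rpow_of_signedPow_eq hp (hv0 t ht) (neg_neg _).symm)
  · rw [← hpow t ht, ← he.equation t ht]
    exact (k2 t ht).neg

/-- Proportionality leaves a factor `s`, the normalization gives `s^p = 1`, and equal functions have
equal spectral numbers by `λ ∫ |f|^q = 1`. -/
lemma unique (hT : 0 < T) (hp : 1 < p) (hq : 1 < q) (hf : IsFirstSpectralCouple p q T f lam)
    (hg : IsFirstSpectralCouple p q T g mu) : EqOn g f (Icc 0 T) ∧ mu = lam := by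
  have hpp := Real.HolderConjugate.conjExponent hp
  obtain ⟨s, hs, he⟩ := IsPosSol.exists_eq_const_mul hpp.symm.sub_one_pos (by linarith)
    hg.couple.eigenpair.pos hf.couple.eigenpair.pos (hg.isPosSol hT hpp hq) (hf.isPosSol hT hpp hq)
  obtain ⟨h1, h2, -⟩ := hasDerivWithinAt_segDeriv hT hf.couple.eigenpair.contDiffOn
  have hd := segDeriv2_eq hT (f := g)
    (fun t ht => ((h1 t ht).const_mul s).congr he (he t ht)) (fun t ht => (h2 t ht).const_mul s)
  have hn := hg.couple.integral_deriv2 hT hp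
  have e : ∫ t, |segDeriv2 T g t| ^ p ∂(segMeasure T)
      = ∫ t, s ^ p * |segDeriv2 T f t| ^ p ∂(segMeasure T) := integral_seg_congr fun t ht => by
    rw [hd ht, abs_mul, abs_of_pos hs, Real.mul_rpow hs.le (abs_nonneg _)]
  rw [e, integral_const_mul, hf.couple.integral_deriv2 hT hp, mul_one,
    ← Real.one_rpow p, Real.rpow_left_inj hs.le zero_le_one (by linarith)] at hn
  have heq : EqOn g f (Icc 0 T) := fun t ht => by rw [he t ht, hn, one_mul]
  refine ⟨heq, ?_⟩
  have i1 := hf.couple.mul_integral_eq_one hT hp hq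
  have i2 := hg.couple.mul_integral_eq_one hT hp hq
  have e' : ∫ t, |g t| ^ q ∂(segMeasure T) = ∫ t, |f t| ^ q ∂(segMeasure T) :=
    integral_seg_congr fun t ht => by simp only [heq ht]
  rw [e', ← i1] at i2
  refine mul_right_cancel₀ (fun h0 => ?_) i2
  rw [h0, mul_zero] at i1
  exact zero_ne_one i1

end IsFirstSpectralCouple

/-- A maximizer of the energy yields a first spectral couple. -/
lemma exists_isFirstSpectralCouple (hT : 0 < T) (hp : 1 < p) (hq : 1 < q) :
    ∃ f, IsFirstSpectralCouple p q T f (maxEnergy p q T)⁻¹ ∧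
      segNorm q T f = maxEnergy p q T ^ (1 / q) := by
  have hpp := Real.HolderConjugate.conjExponent hp
  obtain ⟨w, hw, hmax⟩ := exists_admissible_energy_eq (q := q) hT hp hq
  obtain ⟨hnorm, hEL⟩ := hw.euler_lagrange hT hpp hq hmax
  set p' := p.conjExponent
  set K := maxEnergy p q T
  have hK : 0 < K := maxEnergy_pos hT hp hq
  have hwi : Integrable w (segMeasure T) := integrable_seg hw.continuous.continuousOn
  have hw0 : ∀ t ∈ Icc 0 T, 0 ≤ w t := fun t _ => hw.nonneg t
  obtain ⟨t₁, ht₁, hwp⟩ : ∃ t ∈ Icc 0 T, 0 < w t := by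
    by_contra! hne
    have : ∫ t, w t ^ p ∂(segMeasure T) = ∫ _, (0:ℝ) ∂(segMeasure T) :=
      integral_seg_congr fun t ht => by
        rw [le_antisymm (hne t ht) (hw.nonneg t), Real.zero_rpow (by linarith)]
    rw [hnorm, integral_zero] at this
    exact one_ne_zero this
  have hfpos : ∀ t ∈ Ioo 0 T, 0 < green T w t := fun t ht =>
    green_pos hT hw.continuous.continuousOn hw0 ht₁ hwp ht
  have hf0 : ∀ t ∈ Icc 0 T, 0 ≤ green T w t := fun t ht =>
    green_nonneg hT (Eventually.of_forall hw.nonneg) ht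
  have d1 : ∀ t ∈ Icc 0 T, HasDerivWithinAt (green T w) (greenDeriv T w t) (Icc 0 T) t :=
    fun t ht => hasDerivWithinAt_green hT hw.continuous ht
  have d2 : ∀ t ∈ Icc 0 T, HasDerivWithinAt (greenDeriv T w) (-w t) (Icc 0 T) t :=
    fun t _ => (hasDerivAt_greenDeriv T hw.continuous t).hasDerivWithinAt
  have e2 := segDeriv2_eq hT d1 d2
  set dens : ℝ → ℝ := fun t => |green T w t| ^ (q - 1)
  have hdens : Continuous dens := continuous_energyGrad_density hT hq hwi
  -- The Euler–Lagrange equation raised to the power `p - 1`, using `(p' - 1)(p - 1) = 1`. The right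
  -- side is a Green potential, hence twice differentiable.
  have hpow : EqOn (fun t => signedPow p (segDeriv2 T (green T w) t))
      (fun t => -(energyGrad q T w t / K)) (Icc 0 T) := fun t ht => by
    have hx : 0 ≤ energyGrad q T w t / K := div_nonneg (energyGrad_nonneg hT q w ht) hK.le
    simp only
    rw [e2 ht, signedPow_neg, signedPow_of_nonneg hp (hw.nonneg t), hEL t ht,
      ← Real.rpow_mul hx, show (p' - 1) * (p - 1) = 1 by linarith [hpp.mul_eq_add], Real.rpow_one]
  have k1 : ∀ t ∈ Icc 0 T, HasDerivWithinAt
      (fun t => signedPow p (segDeriv2 T (green T w) t)) (-(greenDeriv T dens t / K))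
      (Icc 0 T) t := fun t ht =>
    (((hasDerivWithinAt_green hT hdens ht).div_const K).neg).congr hpow (hpow ht)
  have k2 : ∀ t ∈ Icc 0 T, HasDerivWithinAt (fun t => -(greenDeriv T dens t / K))
      (-(-dens t / K)) (Icc 0 T) t := fun t _ =>
    ((hasDerivAt_greenDeriv T hdens t).div_const K).neg.hasDerivWithinAt
  -- The conditions on `f''` are natural boundary conditions: they are not imposed on the
  -- competitors but inherited from the vanishing of `energyGrad` at the ends.
  have hend : ∀ t ∈ Icc 0 T, energyGrad q T w t = 0 → segDeriv2 T (green T w) t = 0 :=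
    fun t ht h => by
      rw [e2 ht]
      simp only
      rw [hEL t ht, h, zero_div, Real.zero_rpow hpp.symm.sub_one_pos.ne', neg_zero]
  have hm : T / 2 ∈ Ioo 0 T := ⟨by linarith, by linarith⟩
  have h0 : (0:ℝ) ∈ Icc 0 T := left_mem_Icc.2 hT.le
  refine ⟨green T w, ⟨⟨⟨contDiffOn_two hT d1 d2 hw.continuous.neg.continuousOn,
    contDiffOn_two hT k1 k2 (hdens.neg.div_const K).neg.continuousOn, fun t ht => ?_,
    green_zero T w, green_end hT w, hend 0 h0 (green_zero T _),
    hend T (right_mem_Icc.2 hT.le) (green_end hT _),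
    ⟨T / 2, Ioo_subset_Icc_self hm, (hfpos _ hm).ne'⟩, inv_pos.2 hK⟩, ?_, ?_⟩,
    fun t ht => (hfpos t ht).ne'⟩, ?_⟩
  · rw [segDeriv2_eq hT k1 k2 ht, signedPow_of_nonneg hq (hf0 t ht)]
    simp only [dens, abs_of_nonneg (hf0 t ht)]
    ring
  · rw [segNorm_eq hp (memLp_seg (hw.continuous.neg.continuousOn.congr e2) _)]
    have : ∫ t, |segDeriv2 T (green T w) t| ^ p ∂(segMeasure T) = 1 := by
      rw [← hnorm]
      refine integral_seg_congr fun t ht => ?_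
      rw [e2 ht, abs_neg, abs_of_nonneg (hw.nonneg t)]
    rw [this, Real.one_rpow]
  · rw [segDeriv_eq hT d1 h0, greenDeriv, intervalIntegral.integral_same, sub_zero,
      ← integral_seg hT.le]
    obtain ⟨s, hs, hsp⟩ := exists_mem_Ioo_pos hT hw.continuous.continuousOn ht₁ hwp
    exact integral_seg_pos hT
      (((continuous_const.sub continuous_id).div_const T).mul hw.continuous).continuousOn
      (fun t ht => mul_nonneg (div_nonneg (sub_nonneg.2 ht.2) hT.le) (hw.nonneg t))
      (Ioo_subset_Icc_self hs) (mul_pos (div_pos (sub_pos.2 hs.2) hT) hsp)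
  · rw [segNorm_green hT hq hwi, hmax]

lemma exists_isTheFirstSpectralCouple (hT : 0 < T) (hp : 1 < p) (hq : 1 < q) :
    ∃ f, IsTheFirstSpectralCouple p q T f (maxEnergy p q T)⁻¹ ∧
      segNorm q T f = maxEnergy p q T ^ (1 / q) := by
  obtain ⟨f, hf, hn⟩ := exists_isFirstSpectralCouple hT hp hq
  refine ⟨f, ⟨hf, fun g mu hg => hf.unique hT hp hq hg, ⟨f, hf.couple⟩, ?_⟩, hn⟩
  rintro mu ⟨g, hg⟩
  exact hg.inv_maxEnergy_le hT hp hq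

end Navier

end

/-! ### The embedding constant. -/

theorem mainTheorem4 (p q : ℝ) [Fact (1 < p)] [Fact (1 < q)] (t₀ : ℝ) (ht₀ : 0 < t₀) :
    ∃ (SN₁ : ℝ → ℝ) (sn₁ : ℝ) (f₁ : ℝ → ℝ) (lam₁ : ℝ),
      Navier.IsTheFirstSpectralCouple p q t₀ SN₁ sn₁ ∧
      Navier.IsTheFirstSpectralCouple p q 1 f₁ lam₁ ∧
      ∃ E₂ : Navier.SobolevD p t₀ →L[ℝ] Navier.LSeg q t₀,
        (∀ u : Navier.SobolevD p t₀, E₂ u =ᵐ[Navier.segMeasure t₀] u.fn) ∧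
        IsLUB {r : ℝ | ∃ u : Navier.SobolevD p t₀, u ≠ 0 ∧
          r = ‖E₂ u‖ / ‖Navier.SobolevD.deriv2 u‖} ‖E₂‖ ∧
        ‖E₂‖ = Navier.segNorm q t₀ SN₁ ∧
        Navier.segNorm q t₀ SN₁ = sn₁ ^ (-(1 / q)) ∧
        sn₁ ^ (-(1 / q)) = t₀ ^ (1 / q - 1 / p + 2) * lam₁ ^ (-(1 / q)) := by
  have hp : 1 < p := Fact.out
  have hq : 1 < q := Fact.out
  obtain ⟨f, hf, hfn⟩ := Navier.exists_isTheFirstSpectralCouple (T := t₀) ht₀ hp hq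
  obtain ⟨f₁, hf₁, -⟩ := Navier.exists_isTheFirstSpectralCouple (T := 1) one_pos hp hq
  obtain ⟨E, hE, hEle⟩ := Navier.exists_embedding (p := p) (q := q) ht₀
  have he := hf.first.couple.eigenpair
  obtain ⟨h1, h2, h3⟩ := Navier.hasDerivWithinAt_segDeriv ht₀ he.contDiffOn
  obtain ⟨u, hu, hu''⟩ := Navier.SobolevD.exists_of_hasDerivWithinAt (p := p) ht₀ h1 h2 h3
    he.left he.right
  have hK : 0 < Navier.maxEnergy p q t₀ := Navier.maxEnergy_pos ht₀ hp hq
  have hK₁ : 0 < Navier.maxEnergy p q 1 := Navier.maxEnergy_pos one_pos hp hq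
  have hud : ‖Navier.SobolevD.deriv2 u‖ = 1 := by
    rw [Navier.norm_LSeg, Navier.segNorm_congr hu'', hf.first.couple.norm_deriv2]
  have huE : ‖E u‖ = Navier.maxEnergy p q t₀ ^ (1 / q) := by
    rw [Navier.norm_LSeg, Navier.segNorm_congr ((hE u).trans hu), hfn]
  have hu0 : u ≠ 0 := by
    rintro rfl
    rw [map_zero, norm_zero] at hud
    exact zero_ne_one hud
  -- The upper bound is the variational inequality; it is attained at the first eigenfunction, so
  -- the supremum is a maximum.
  have hEn : ‖E‖ = Navier.maxEnergy p q t₀ ^ (1 / q) := by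
    refine le_antisymm hEle ?_
    have := E.le_opNorm u
    rwa [huE, Navier.SobolevD.norm_eq, hud, mul_one] at this
  have hinv : ∀ x : ℝ, 0 < x → x⁻¹ ^ (-(1 / q)) = x ^ (1 / q) := fun x hx => by
    rw [Real.inv_rpow hx.le, Real.rpow_neg hx.le, inv_inv]
  refine ⟨f, _, f₁, _, hf, hf₁, E, hE, ⟨?_, fun b hb => ?_⟩, ?_, ?_, ?_⟩
  · rintro r ⟨v, -, rfl⟩
    exact div_le_of_le_mul₀ (norm_nonneg _) (norm_nonneg _) (E.le_opNorm v)
  · refine hb ⟨u, hu0, ?_⟩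
    rw [hEn, huE, hud, div_one]
  · rw [hEn, hfn]
  · rw [hfn, hinv _ hK]
  -- The exponent is `(1 + 2q - q/p) / q`.
  · rw [hinv _ hK, hinv _ hK₁, Navier.maxEnergy_eq ht₀ hp hq,
      Real.mul_rpow (by positivity) hK₁.le, ← Real.rpow_mul ht₀.le]
    congr 2
    field_simp
    ring
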